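/- Let $M$ be a smooth (Hausdorff, second countable) $d$-dimensional manifold with a $p$-brane Newton–Cartan structure: a symmetric covariant tensor field $\tau_{ab}$ of rank $p+1$ and Lorentzian signature and a symmetric contravariant tensor field $h^{ab}$ of rank $d-p-1$ and Riemannian signature with $h^{ab}\tau_{bc}=0$. Let $\eta=\mathrm{diag}(-1,1,\dots,1)$, let indices $A,B,\dots$ run from $0$ to $p$, and call a vector field $V$ transverse if $\tau(V,\cdot)=0$. Let $\gamma$ be the Riemannian metric on transverse vectors inverse to $h$. A longitudinal frame is a tuple of smooth vector fields $\tau_A$ with $\tau(\tau_A,\tau_B)=\eta_{AB}$; its dual co-frame is $\tau^A=\eta^{AB}\tau(\tau_B,\cdot)$, and $\overset{\tau}{h}(X,Y)=\gamma(PX,PY)$ with $PX=X-\tau^A(X)\tau_A$. Write $\overset{\tau}{h}(X)=\overset{\tau}{h}(X,\cdot)$. Suppose that the structure is Augustinian, i.e. $d\tau^A(V,W)=0$ and $\eta_{A(B}d\tau^A(\tau_{C)},V)=0$ for all transverse $V,W$ and all local longitudinal frames, and that a global longitudinal frame exists; from now on frames are global. Let $D_0$ be the set of torsion-free affine connections with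 $\nabla\tau=0$ and $\nabla h=0$. For a longitudinal frame $\tau_A$ let $\mathcal F^\tau$ be the quotient of $\bigoplus_{p+1}\Omega^2(M)$ by the subspace of the tuples $K_A$ with $K_A(\tau_B,V)=-K_B(\tau_A,V)$ and $K_A(V,W)=0$ for all transverse $V,W$, and denote by $[F_A]_\tau$ the class of $F_A$. Let $\overset{\tau}{\nabla}\in D_0$, with coefficients $\overset{\tau}{\Gamma}$, be the (unique) connection for which $F_A(X,Y)=\overset{\tau}{h}(\overset{\tau}{\nabla}_X\tau_A,Y)-\overset{\tau}{h}(\overset{\tau}{\nabla}_Y\tau_A,X)$ satisfies $[F_A]_\tau=0$. The pair $(\tau_A,[F_A]_\tau)$ is sent to the connection $\Gamma^c_{ab}=\overset{\tau}{\Gamma}{}^c_{ab}+\tau^A_{(a}F_{|A|b)e}h^{ce}$, where $(ab)$ is symmetrisation with weight $\tfrac12$. Let $C^\infty(M,LG_p)$ be the group of pairs $(\Lambda,V)$ with $\Lambda\in C^\infty(M,O(1,p))$ and $V_A$ transverse smooth vector fields, with product $(\Lambda,V)(\Lambda',V')=(\Lambda\Lambda',\Lambda'^B{}_AV_B+V'_A)$.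 (1) Any two longitudinal frames are related by $\tau'_A=\Lambda^B{}_A\tau_B+V_A$ for a unique $(\Lambda,V)$, and then $\tau'^A=(\Lambda^{-1})^A{}_B\tau^B$. (2) If $\tau'_A=\Lambda^B{}_A\tau_B+V_A$ and $(\tau_A,[F_A]_\tau)$, $(\tau'_A,[F'_A]_{\tau'})$ are sent to the same connection, then, with $W_B=(\Lambda^{-1})^C{}_BV_C$, $$[F'_A]_{\tau'}=\Big[\Lambda^B{}_A\Big(F_B+d\overset{\tau}{h}(W_B)+\tfrac12\tau^D\wedge d\big(\overset{\tau}{h}(W_D,W_B)\big)+\Delta^D{}_B\wedge\overset{\tau}{h}(W_D)+\tfrac12\eta^{DE}\eta_{CF}\,d\tau^F(\tau_B,\tau_E)\,\overset{\tau}{h}(W_D)\wedge\tau^C-\overset{\tau}{h}(W_C,W_D)\,\Delta^D{}_B\wedge\tau^C\Big)\Big]_{\tau'},\qquad(\ast)$$ where $\Delta^D{}_B=\tfrac12\big(\eta^{DE}\eta_{BF}\,d\tau^F(\tau_E,\cdot)-d\tau^D(\tau_B,\cdot)\big)$. (3) The rule $(\tau_A,[F_A]_\tau)\cdot(\Lambda,V)=(\tau'_A,[F'_A]_{\tau'})$,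 with $\tau'_A=\Lambda^B{}_A\tau_B+V_A$ and $[F'_A]_{\tau'}$ given by $(\ast)$, is a well-defined right action of $C^\infty(M,LG_p)$ on $\bigsqcup_{\tau_A}\mathcal F^\tau$. The map from pairs to connections is well defined, takes its values in $D_0$, is constant on orbits, and induces a bijection from the orbit space onto $D_0$. -/

import Mathlib

open scoped Manifold ContDiff

noncomputable section

namespace PNC

/-! ## Functions, vector fields, tensor fields and connections on a smooth manifold -/

section Calculus

variable (d : ℕ) (M : Type*) [TopologicalSpace M] [ChartedSpace (EuclideanSpace ℝ (Fin d)) M]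

/-- The ring `C^∞(M)` of smooth real functions. -/
def Fn : Type _ := C^∞⟮𝓡 d, M; 𝓘(ℝ, ℝ), ℝ⟯

instance : CommRing (Fn d M) := inferInstanceAs (CommRing C^∞⟮𝓡 d, M; 𝓘(ℝ, ℝ), ℝ⟯)

instance : Algebra ℝ (Fn d M) := inferInstanceAs (Algebra ℝ C^∞⟮𝓡 d, M; 𝓘(ℝ, ℝ), ℝ⟯)

instance : FunLike (Fn d M) M ℝ := inferInstanceAs (FunLike C^∞⟮𝓡 d, M; 𝓘(ℝ, ℝ), ℝ⟯ M ℝ)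

variable {d M} in
theorem Fn.contMDiff (f : Fn d M) : ContMDiff (𝓡 d) 𝓘(ℝ, ℝ) ∞ f := ContMDiffMap.contMDiff f

variable {d M} in
@[ext] theorem Fn.ext {f g : Fn d M} (h : ∀ q, f q = g q) : f = g := DFunLike.ext f g h

variable {d M} in
@[simp] theorem Fn.add_apply (f g : Fn d M) (q : M) : (f + g) q = f q + g q := rfl

variable {d M} in
@[simp] theorem Fn.mul_apply (f g : Fn d M) (q : M) : (f * g) q = f q * g q := rfl

variable [IsManifold (𝓡 d) ∞ M]

/-- The space `Γ(TM)` of smooth vector fields. -/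
def VField : Type _ :=
  Cₛ^∞⟮𝓡 d; EuclideanSpace ℝ (Fin d), (TangentSpace (𝓡 d) : M → Type _)⟯

instance : AddCommGroup (VField d M) := inferInstanceAs
  (AddCommGroup Cₛ^∞⟮𝓡 d; EuclideanSpace ℝ (Fin d), (TangentSpace (𝓡 d) : M → Type _)⟯)

instance : DFunLike (VField d M) M (fun q => TangentSpace (𝓡 d) q) := inferInstanceAs
  (DFunLike Cₛ^∞⟮𝓡 d; EuclideanSpace ℝ (Fin d), (TangentSpace (𝓡 d) : M → Type _)⟯ M
    (fun q => TangentSpace (𝓡 d) q))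

variable {d M}

theorem VField.contMDiff (X : VField d M) :
    ContMDiff (𝓡 d) (𝓡 d).tangent ∞ (fun q => (⟨q, X q⟩ : TangentBundle (𝓡 d) M)) :=
  ContMDiffSection.contMDiff X

@[ext] theorem VField.ext {X Y : VField d M} (h : ∀ q, X q = Y q) : X = Y := DFunLike.ext X Y h

/-- Multiplication of vector fields by smooth functions. -/
instance : SMul (Fn d M) (VField d M) :=
  ⟨fun f X => ⟨fun q => f q • X q, f.contMDiff.smul_section X.contMDiff⟩⟩

theorem VField.smul_apply (f : Fn d M) (X : VField d M) (q : M) : (f • X) q = f q • X q := rfl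

instance : Module (Fn d M) (VField d M) where
  one_smul X := VField.ext fun q => one_smul ℝ (X q)
  mul_smul f g X := VField.ext fun q => mul_smul (f q) (g q) (X q)
  smul_zero f := VField.ext fun q => smul_zero (f q)
  smul_add f X Y := VField.ext fun q => smul_add (f q) (X q) (Y q)
  add_smul f g X := VField.ext fun q => add_smul (f q) (g q) (X q)
  zero_smul X := VField.ext fun q => zero_smul ℝ (X q)

/-- The derivative `X(f)` of a smooth function along a vector field, `q ↦ df_q(X_q)`. -/
def lieDeriv (X : VField d M) (f : Fn d M) : Fn d M :=
  ⟨fun q => (mfderiv (𝓡 d) 𝓘(ℝ, ℝ) f q (X q) : ℝ), by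
    have h1 : ContMDiff (𝓡 d).tangent 𝓘(ℝ, ℝ).tangent ∞ (tangentMap (𝓡 d) 𝓘(ℝ, ℝ) f) :=
      f.contMDiff.contMDiff_tangentMap (by simp)
    have h2 := (contMDiff_snd_tangentBundle_modelSpace (n := ∞) ℝ 𝓘(ℝ, ℝ)).comp
      (h1.comp X.contMDiff)
    exact h2⟩

theorem lieDeriv_apply (X : VField d M) (f : Fn d M) (q : M) :
    lieDeriv X f q = (mfderiv (𝓡 d) 𝓘(ℝ, ℝ) f q (X q) : ℝ) := rfl

/-- The Lie bracket `[X, Y]` of two smooth vector fields. -/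
def bracket (X Y : VField d M) : VField d M :=
  ⟨VectorField.mlieBracket (𝓡 d) X Y, fun q => by
    have : IsManifold (𝓡 d) (minSmoothness ℝ 2) M := by
      rw [minSmoothness_of_isRCLikeNormedField]
      infer_instance
    have : IsManifold (𝓡 d) (((⊤ : ℕ∞) : WithTop ℕ∞) + 1) M := ‹IsManifold (𝓡 d) ∞ M›
    exact ContMDiffAt.mlieBracket_vectorField (m := ⊤) (n := ⊤) X.contMDiff.contMDiffAt
      Y.contMDiff.contMDiffAt (by simp)⟩

theorem lieDeriv_add (X : VField d M) (f g : Fn d M) :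
    lieDeriv X (f + g) = lieDeriv X f + lieDeriv X g := by
  ext q
  have hf : MDifferentiableAt (𝓡 d) 𝓘(ℝ, ℝ) f q := f.contMDiff.mdifferentiable (by simp) q
  have hg : MDifferentiableAt (𝓡 d) 𝓘(ℝ, ℝ) g q := g.contMDiff.mdifferentiable (by simp) q
  have h := (hf.hasMFDerivAt.add hg.hasMFDerivAt).mfderiv
  exact congrArg (fun L => (L (X q) : ℝ)) h

theorem lieDeriv_mul (X : VField d M) (f g : Fn d M) :
    lieDeriv X (f * g) = f * lieDeriv X g + g * lieDeriv X f := by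
  ext q
  have hf : MDifferentiableAt (𝓡 d) 𝓘(ℝ, ℝ) f q := f.contMDiff.mdifferentiable (by simp) q
  have hg : MDifferentiableAt (𝓡 d) 𝓘(ℝ, ℝ) g q := g.contMDiff.mdifferentiable (by simp) q
  have h := (hf.hasMFDerivAt.mul hg.hasMFDerivAt).mfderiv
  exact congrArg (fun L => (L (X q) : ℝ)) h

variable (d M) in
/-- The space `Ω¹(M)` of 1-forms, i.e. `C^∞(M)`-linear maps `Γ(TM) → C^∞(M)`. -/
abbrev OneForm := VField d M →ₗ[Fn d M] Fn d M

variable (d M) in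
/-- The space `Ω²(M)` of 2-forms, i.e. alternating `C^∞(M)`-bilinear maps
`Γ(TM) × Γ(TM) → C^∞(M)`. -/
abbrev TwoForm := VField d M [⋀^Fin 2]→ₗ[Fn d M] Fn d M

/-- The 1-form `F(X, ·)`. -/
def contract (F : TwoForm d M) (X : VField d M) : OneForm d M :=
  (AlternatingMap.ofSubsingleton (Fn d M) (VField d M) (Fn d M) (0 : Fin 1)).symm (F.curryLeft X)

theorem contract_apply (F : TwoForm d M) (X Y : VField d M) : contract F X Y = F ![X, Y] := by
  have h : (![X, Y] : Fin 2 → VField d M) = Matrix.vecCons X (fun _ => Y) := by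
    funext i
    fin_cases i <;> rfl
  rw [h]
  rfl

/-- `dα(X, Y) = X(α(Y)) - Y(α(X)) - α([X, Y])`, the exterior derivative of a 1-form `α`. -/
def extDeriv (α : VField d M → Fn d M) (X Y : VField d M) : Fn d M :=
  lieDeriv X (α Y) - lieDeriv Y (α X) - α (bracket X Y)

/-- `df(X) = X(f)`, the differential of a function. -/
def differential (f : Fn d M) (X : VField d M) : Fn d M := lieDeriv X f

/-- `(α ∧ β)(X, Y) = α(X) β(Y) - α(Y) β(X)`, the wedge product of 1-forms. -/
def wedge (α β : VField d M → Fn d M) (X Y : VField d M) : Fn d M :=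
  α X * β Y - α Y * β X

variable (d M) in
/-- A (Koszul) connection on `TM`; `toFun X Y` is `∇_X Y`. -/
@[ext] structure Connection where
  toFun : VField d M → VField d M → VField d M
  add_left : ∀ X X' Y, toFun (X + X') Y = toFun X Y + toFun X' Y
  smul_left : ∀ (f : Fn d M) X Y, toFun (f • X) Y = f • toFun X Y
  add_right : ∀ X Y Y', toFun X (Y + Y') = toFun X Y + toFun X Y'
  leibniz : ∀ X (f : Fn d M) Y, toFun X (f • Y) = lieDeriv X f • Y + f • toFun X Y

instance : CoeFun (Connection d M) (fun _ => VField d M → VField d M → VField d M) :=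
  ⟨Connection.toFun⟩

/-- The induced derivative of 1-forms, `(∇_X α)(Y) = X(α(Y)) - α(∇_X Y)`. -/
def Connection.covDerivOneForm (D : Connection d M) (X : VField d M) (α : OneForm d M) :
    OneForm d M where
  toFun Y := lieDeriv X (α Y) - α (D X Y)
  map_add' Y Y' := by
    rw [map_add, lieDeriv_add, D.add_right, map_add]
    ring
  map_smul' f Y := by
    rw [map_smul, smul_eq_mul, lieDeriv_mul, D.leibniz, map_add, map_smul, map_smul]
    simp only [smul_eq_mul, RingHom.id_apply]
    ring

/-- The torsion `T(X, Y) = ∇_X Y - ∇_Y X - [X, Y]`. -/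
def Connection.torsion (D : Connection d M) (X Y : VField d M) : VField d M :=
  D X Y - D Y X - bracket X Y

/-- The values at `q` of the vector fields `E i` form a basis of `T_q M`. -/
def IsBasisAt {ι : Type} (q : M) (E : ι → VField d M) : Prop :=
  LinearIndependent ℝ (fun i => E i q) ∧ Submodule.span ℝ (Set.range fun i => E i q) = ⊤

end Calculus

/-- The Lorentz metric `η = diag(-1, 1, ..., 1)` in `p + 1` dimensions. It is its own inverse,
so that the same matrix serves for `η_{AB}` and `η^{AB}`. -/
def eta (p : ℕ) (R : Type*) [CommRing R] : Matrix (Fin (p + 1)) (Fin (p + 1)) R :=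
  Matrix.diagonal fun A => if A = 0 then -1 else 1

theorem eta_mul_eta (p : ℕ) (R : Type*) [CommRing R] : eta p R * eta p R = 1 := by
  rw [eta, Matrix.diagonal_mul_diagonal, ← Matrix.diagonal_one]
  congr 1
  ext A
  split_ifs <;> simp

theorem sum_eta_mul_eta (p : ℕ) (R : Type*) [CommRing R] (A C : Fin (p + 1)) :
    ∑ B, eta p R A B * eta p R B C = if A = C then 1 else 0 := by
  have h := congrFun (congrFun (eta_mul_eta p R) A) C
  rwa [Matrix.mul_apply, Matrix.one_apply] at h

/-! ## `p`-brane Newton-Cartan structures -/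

section Structure

variable (d p : ℕ) (M : Type*) [TopologicalSpace M]
  [ChartedSpace (EuclideanSpace ℝ (Fin d)) M] [IsManifold (𝓡 d) ∞ M]

/-- A `p`-brane Newton-Cartan structure on the `d`-dimensional manifold `M`: a symmetric covariant
tensor `τ_{ab}` of rank `p + 1` and Lorentzian signature, and a symmetric contravariant tensor
`h^{ab}` of rank `d - p - 1` and Riemannian signature, with `h^{ab} τ_{bc} = 0`.
Rank and signature are expressed pointwise by Sylvester normal forms: at each point `q` there is
a basis of `T_q M` in which `τ` is `diag(-1, 1, ..., 1, 0, ..., 0)`, and a basis of `T_q^* M`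
(dual to a basis of `T_q M`) in which `h` is `diag(0, ..., 0, 1, ..., 1)`. -/
structure PNCStructure where
  τ : VField d M →ₗ[Fn d M] VField d M →ₗ[Fn d M] Fn d M
  h : OneForm d M →ₗ[Fn d M] OneForm d M →ₗ[Fn d M] Fn d M
  τ_symm : ∀ X Y, τ X Y = τ Y X
  h_symm : ∀ α β, h α β = h β α
  τ_signature : ∀ q : M, ∃ E : Fin (p + 1) ⊕ Fin (d - (p + 1)) → VField d M,
    IsBasisAt q E ∧
    (∀ A B, τ (E (Sum.inl A)) (E (Sum.inl B)) q = eta p ℝ A B) ∧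
    (∀ i j, τ (E (Sum.inr i)) (E j) q = 0)
  h_signature : ∀ q : M, ∃ (E : Fin (p + 1) ⊕ Fin (d - (p + 1)) → VField d M)
    (θ : Fin (p + 1) ⊕ Fin (d - (p + 1)) → OneForm d M),
    IsBasisAt q E ∧
    (∀ i j, θ i (E j) q = if i = j then 1 else 0) ∧
    (∀ i j, h (θ (Sum.inr i)) (θ (Sum.inr j)) q = if i = j then 1 else 0) ∧
    (∀ A j, h (θ (Sum.inl A)) (θ j) q = 0)
  orthogonal : ∀ (β : OneForm d M) (X : VField d M), h β (τ X) = 0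

end Structure

namespace PNCStructure

variable {d p : ℕ} {M : Type*} [TopologicalSpace M]
  [ChartedSpace (EuclideanSpace ℝ (Fin d)) M] [IsManifold (𝓡 d) ∞ M]
  (S : PNCStructure d p M)

/-- The space `Γ(Ker(M, τ))` of transverse vector fields. -/
def Ker : Submodule (Fn d M) (VField d M) := LinearMap.ker S.τ

/-- The 1-forms `τ^A = η^{AB} τ(τ_B, ·)` attached to a tuple of vector fields. If
`τ(τ_A, τ_B) = η_{AB}`, these are the only 1-forms with `τ = η_{AB} τ^A ⊗ τ^B` and
`τ^A(τ_B) = δ^A_B`. -/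
def coframe (t : Fin (p + 1) → VField d M) (A : Fin (p + 1)) : OneForm d M :=
  ∑ B, eta p (Fn d M) A B • S.τ (t B)

/-- An Augustinian structure: `dτ^A(V, W) = 0` and `η_{A(B} dτ^A(τ_{C)}, V) = 0` for transverse
`V`, `W`, where `τ_A` is any local longitudinal frame. A local frame near a point is given here by
globally defined vector fields `t A` which satisfy the orthonormality relations on an open set
`U`. -/
def IsAugustinian : Prop :=
  ∀ (U : Set M) (_ : IsOpen U) (t : Fin (p + 1) → VField d M),
    (∀ q ∈ U, ∀ A B, S.τ (t A) (t B) q = eta p ℝ A B) →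
    ∀ V ∈ S.Ker, ∀ W ∈ S.Ker, ∀ q ∈ U,
      (∀ A, extDeriv (S.coframe t A) V W q = 0) ∧
      (∀ B C, ∑ A, (eta p ℝ A B * extDeriv (S.coframe t A) (t C) V q
        + eta p ℝ A C * extDeriv (S.coframe t A) (t B) V q) = 0)

/-- The space of (global, smooth) longitudinal frames. -/
@[ext] structure LongitudinalFrame where
  vec : Fin (p + 1) → VField d M
  orthonormal : ∀ A B, S.τ (vec A) (vec B) = eta p (Fn d M) A B

instance : CoeFun S.LongitudinalFrame (fun _ => Fin (p + 1) → VField d M) :=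
  ⟨LongitudinalFrame.vec⟩

theorem coframe_apply (t : S.LongitudinalFrame) (A C : Fin (p + 1)) :
    S.coframe t A (t C) = if A = C then 1 else 0 := by
  rw [← sum_eta_mul_eta p (Fn d M) A C]
  simp [coframe, LinearMap.sum_apply, t.orthonormal]

/-- The projector `P(X) = X - τ^A(X) τ_A` onto transverse vector fields. -/
def proj (t : S.LongitudinalFrame) (X : VField d M) : VField d M :=
  X - ∑ A, S.coframe t A X • t A

open Classical in
/-- The Riemannian metric `γ` on `Ker(M, τ)` which is inverse to `h`: one has `γ(V, W) = α(W)` for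
transverse `V`, `W` and any 1-form `α` with `V^a = h^{ab} α_b`. -/
def γ (V W : VField d M) : Fn d M :=
  if H : ∃ α : OneForm d M, ∀ β : OneForm d M, β V = S.h β α then H.choose W else 0

/-- The field `h_{ab}` associated to a longitudinal frame, `h(X, Y) = γ(P X, P Y)`. -/
def hLower (t : S.LongitudinalFrame) (X Y : VField d M) : Fn d M :=
  S.γ (S.proj t X) (S.proj t Y)

/-! ### Compatible connections and field strengths -/

/-- `∇ τ = 0` and `∇ h = 0`. -/
def IsCompatible (D : Connection d M) : Prop :=
  (∀ X Y Z, lieDeriv X (S.τ Y Z) - S.τ (D X Y) Z - S.τ Y (D X Z) = 0) ∧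
  (∀ X α β, lieDeriv X (S.h α β) - S.h (D.covDerivOneForm X α) β
    - S.h α (D.covDerivOneForm X β) = 0)

/-- The space of compatible torsion-free connections. -/
def TorsionFreeConnection : Type _ :=
  {D : Connection d M // S.IsCompatible D ∧ ∀ X Y, D.torsion X Y = 0}

/-- The conditions `K_A(τ_B, V) = -K_B(τ_A, V)` and `K_A(V, W) = 0` for all transverse `V`, `W`. -/
def IsGauge (t : S.LongitudinalFrame) (K : Fin (p + 1) → VField d M → VField d M → Fn d M) :
    Prop :=
  (∀ A B, ∀ V ∈ S.Ker, K A (t B) V = -K B (t A) V) ∧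
  (∀ A, ∀ V ∈ S.Ker, ∀ W ∈ S.Ker, K A V W = 0)

/-- The space of those `(p + 1)`-tuples of 2-forms which satisfy `IsGauge`. -/
def gauge (t : S.LongitudinalFrame) : Submodule (Fn d M) (Fin (p + 1) → TwoForm d M) where
  carrier := {K | S.IsGauge t fun A X Y => K A ![X, Y]}
  add_mem' := by
    rintro K L ⟨h1, h2⟩ ⟨h3, h4⟩
    refine ⟨fun A B V hV => ?_, fun A V hV W hW => ?_⟩
    · have e1 := h1 A B V hV
      have e2 := h3 A B V hV
      simp only [Pi.add_apply, AlternatingMap.add_apply] at *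
      rw [e1, e2]
      ring
    · have e1 := h2 A V hV W hW
      have e2 := h4 A V hV W hW
      simp only [Pi.add_apply, AlternatingMap.add_apply] at *
      rw [e1, e2, add_zero]
  zero_mem' := by
    refine ⟨fun A B V hV => ?_, fun A V hV W hW => ?_⟩ <;> simp
  smul_mem' := by
    rintro f K ⟨h1, h2⟩
    refine ⟨fun A B V hV => ?_, fun A V hV W hW => ?_⟩
    · have e1 := h1 A B V hV
      simp only [Pi.smul_apply, AlternatingMap.smul_apply, smul_eq_mul] at *
      rw [e1]
      ring
    · have e1 := h2 A V hV W hW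
      simp only [Pi.smul_apply, AlternatingMap.smul_apply, smul_eq_mul] at *
      rw [e1, mul_zero]

/-- The space of gravitational field strengths `[F_A]` with respect to a longitudinal frame. -/
abbrev FieldStrength (t : S.LongitudinalFrame) : Type _ :=
  (Fin (p + 1) → TwoForm d M) ⧸ S.gauge t

/-- The class `[F_A]` of a `(p + 1)`-tuple of 2-forms. -/
def cls (t : S.LongitudinalFrame) (F : Fin (p + 1) → TwoForm d M) : S.FieldStrength t :=
  (S.gauge t).mkQ F

/-- The polyform `F(∇)_A(X, Y) = h(∇_X τ_A, Y) - h(∇_Y τ_A, X)` induced by a connection, where `h`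
is the covariant tensor associated to the frame. -/
def inducedFieldStrength (t : S.LongitudinalFrame) (D : Connection d M) (A : Fin (p + 1))
    (X Y : VField d M) : Fn d M :=
  S.hLower t (D X (t A)) Y - S.hLower t (D Y (t A)) X

/-- `D` is a torsion-free special connection associated to the frame `t`: it is torsion-free and
compatible, and the field strength which it induces with respect to `t` vanishes as a class. -/
def IsSpecial (t : S.LongitudinalFrame) (D : Connection d M) : Prop :=
  S.IsCompatible D ∧ (∀ X Y, D.torsion X Y = 0) ∧ S.IsGauge t (S.inducedFieldStrength t D)

/-- The disjoint union over all longitudinal frames of the spaces of field strengths. -/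
abbrev Pair : Type _ := Σ t : S.LongitudinalFrame, S.FieldStrength t

/-- The pair `(τ_A, [F_A])` maps to the connection `D`, that is,
`Γ^c_{ab} = Γ₀^c_{ab} + τ^A_{(a} F_{|A| b)e} h^{ce}` for the special connection `Γ₀` associated to
`τ_A` and a representative `F_A`. -/
def MapsTo (x : S.Pair) (D : Connection d M) : Prop :=
  ∃ (D₀ : Connection d M) (F : Fin (p + 1) → TwoForm d M),
    S.IsSpecial x.1 D₀ ∧ x.2 = S.cls x.1 F ∧
    ∀ (X Y : VField d M) (β : OneForm d M), β (D X Y) = β (D₀ X Y) +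
      (1 / 2 : ℝ) • ∑ A, (S.coframe x.1 A X * S.h β (contract (F A) Y)
        + S.coframe x.1 A Y * S.h β (contract (F A) X))

/-! ### The group of local Lorentz transformations and boosts -/

/-- The group of pairs `(Λ, V)` of `Λ ∈ C^∞(M, O(1, p))` and a tuple `V_A` of `p + 1` transverse
vector fields; `Λ^B_A` is the entry `lam B A`. -/
@[ext] structure LG where
  lam : Matrix (Fin (p + 1)) (Fin (p + 1)) (Fn d M)
  boost : Fin (p + 1) → VField d M
  lorentz : lam.transpose * eta p (Fn d M) * lam = eta p (Fn d M)
  transverse : ∀ A, boost A ∈ S.Ker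

namespace LG

variable {S}

theorem inv_mul_lam (g : S.LG) : g.lam⁻¹ * g.lam = 1 := by
  have h : (eta p (Fn d M) * g.lam.transpose * eta p (Fn d M)) * g.lam = 1 := by
    rw [Matrix.mul_assoc, Matrix.mul_assoc, ← Matrix.mul_assoc g.lam.transpose, g.lorentz,
      eta_mul_eta]
  exact Matrix.nonsing_inv_mul _ (Matrix.isUnit_det_of_left_inverse h)

theorem lam_mul_inv (g : S.LG) : g.lam * g.lam⁻¹ = 1 := mul_eq_one_comm.mp g.inv_mul_lam

/-- `(Λ, V) (Λ', V') = (Λ Λ', Λ'^B_A V_B + V'_A)`. -/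
instance : Mul S.LG := ⟨fun g g' =>
  { lam := g.lam * g'.lam
    boost := fun A => ∑ B, g'.lam B A • g.boost B + g'.boost A
    lorentz := by
      conv_rhs => rw [← g'.lorentz, ← g.lorentz]
      simp only [Matrix.transpose_mul, Matrix.mul_assoc]
    transverse := fun A => S.Ker.add_mem
      (S.Ker.sum_mem fun B _ => S.Ker.smul_mem _ (g.transverse B)) (g'.transverse A) }⟩

instance : One S.LG := ⟨
  { lam := 1
    boost := fun _ => 0
    lorentz := by simp
    transverse := fun _ => S.Ker.zero_mem }⟩

instance : Inv S.LG := ⟨fun g =>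
  { lam := g.lam⁻¹
    boost := fun A => -∑ B, g.lam⁻¹ B A • g.boost B
    lorentz := by
      have h : g.lam.transpose * eta p (Fn d M) * g.lam = eta p (Fn d M) := g.lorentz
      have h1 : (g.lam⁻¹).transpose * g.lam.transpose = 1 := by
        rw [← Matrix.transpose_mul, g.lam_mul_inv, Matrix.transpose_one]
      calc (g.lam⁻¹).transpose * eta p (Fn d M) * g.lam⁻¹
          = (g.lam⁻¹).transpose * (g.lam.transpose * eta p (Fn d M) * g.lam) * g.lam⁻¹ := by
            rw [h]
        _ = ((g.lam⁻¹).transpose * g.lam.transpose) * eta p (Fn d M) * (g.lam * g.lam⁻¹) := by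
            simp only [Matrix.mul_assoc]
        _ = eta p (Fn d M) := by rw [h1, g.lam_mul_inv, Matrix.one_mul, Matrix.mul_one]
    transverse := fun A => S.Ker.neg_mem
      (S.Ker.sum_mem fun B _ => S.Ker.smul_mem _ (g.transverse B)) }⟩

theorem mul_lam (g g' : S.LG) : (g * g').lam = g.lam * g'.lam := rfl

theorem mul_boost (g g' : S.LG) (A : Fin (p + 1)) :
    (g * g').boost A = ∑ B, g'.lam B A • g.boost B + g'.boost A := rfl

instance : Group S.LG where
  mul_assoc a b c := by
    ext1
    · simp only [mul_lam, Matrix.mul_assoc]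
    · funext A
      simp only [mul_boost, mul_lam, Matrix.mul_apply, Finset.sum_smul, smul_add,
        Finset.smul_sum, Finset.sum_add_distrib, add_assoc]
      congr 1
      rw [Finset.sum_comm]
      refine Finset.sum_congr rfl fun B _ => Finset.sum_congr rfl fun C _ => ?_
      rw [smul_smul, mul_comm]
  one_mul a := by
    ext1
    · exact Matrix.one_mul _
    · funext A
      rw [mul_boost]
      have h0 : ∀ B, (1 : S.LG).boost B = 0 := fun _ => rfl
      simp [h0]
  mul_one a := by
    ext1
    · exact Matrix.mul_one _
    · funext A
      rw [mul_boost]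
      have h0 : (1 : S.LG).boost A = 0 := rfl
      have h1 : (1 : S.LG).lam = 1 := rfl
      simp [h0, h1, Matrix.one_apply]
  inv_mul_cancel a := by
    ext1
    · exact a.inv_mul_lam
    · funext A
      rw [mul_boost]
      have h0 : ∀ B, (a⁻¹).boost B = -∑ C, a.lam⁻¹ C B • a.boost C := fun _ => rfl
      have h1 : (1 : S.LG).boost A = 0 := rfl
      simp only [h0, h1, smul_neg, Finset.smul_sum, Finset.sum_neg_distrib, smul_smul]
      rw [Finset.sum_comm]
      have h2 : ∀ C, ∑ B, (a.lam B A * a.lam⁻¹ C B) • a.boost C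
          = (if C = A then (1 : Fn d M) else 0) • a.boost C := by
        intro C
        rw [← Finset.sum_smul, ← Matrix.one_apply, ← a.inv_mul_lam, Matrix.mul_apply]
        simp only [mul_comm]
      simp [h2]

end LG

/-- The transformed frame `τ'_A = Λ^B_A τ_B + V_A`. -/
def LongitudinalFrame.act {S : PNCStructure d p M} (t : S.LongitudinalFrame) (g : S.LG) :
    S.LongitudinalFrame where
  vec A := ∑ B, g.lam B A • t B + g.boost A
  orthonormal A C := by
    have hk : ∀ A, S.τ (g.boost A) = 0 := fun A => g.transverse A
    have hk' : ∀ X A, S.τ X (g.boost A) = 0 := fun X A => by rw [S.τ_symm, hk]; rfl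
    have h := congrFun (congrFun g.lorentz A) C
    rw [← h]
    simp only [map_add, map_sum, map_smul, hk, hk', add_zero, LinearMap.sum_apply,
      LinearMap.smul_apply, t.orthonormal, smul_eq_mul, Matrix.mul_apply, Matrix.transpose_apply,
      Finset.sum_mul, Finset.mul_sum, mul_zero, Finset.sum_const_zero]
    refine Finset.sum_congr rfl fun B _ => Finset.sum_congr rfl fun D _ => ?_
    ring

/-! ### The transformation law -/

/-- The transverse vector fields `W_B = (Λ⁻¹)^C_B V_C`. -/
def LG.restBoost {S : PNCStructure d p M} (g : S.LG) (B : Fin (p + 1)) : VField d M :=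
  ∑ C, g.lam⁻¹ C B • g.boost C

/-- The 1-forms `Δ^D_B = ½ (η^{DE} η_{BF} dτ^F(τ_E, ·) - dτ^D(τ_B, ·))`. -/
def Δ (t : S.LongitudinalFrame) (D B : Fin (p + 1)) (X : VField d M) : Fn d M :=
  (1 / 2 : ℝ) • (∑ E, ∑ F, eta p (Fn d M) D E * eta p (Fn d M) B F
      * extDeriv (S.coframe t F) (t E) X
    - extDeriv (S.coframe t D) (t B) X)

/-- With `W_B = (Λ⁻¹)^C_B V_C`, the polyform
`Λ^B_A [ F_B + d(h(W_B)) + ½ τ^D ∧ d(h(W_D, W_B)) + Δ^D_B ∧ h(W_D)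
  + ½ η^{DE} η_{CF} dτ^F(τ_B, τ_E) h(W_D) ∧ τ^C - h(W_C, W_D) Δ^D_B ∧ τ^C ]`,
evaluated on `X`, `Y`. Here `τ_A`, `τ^A`, `h` and `Δ` are those of the frame `t`. -/
def transformed (t : S.LongitudinalFrame) (g : S.LG) (F : Fin (p + 1) → TwoForm d M)
    (A : Fin (p + 1)) (X Y : VField d M) : Fn d M :=
  let W := g.restBoost
  let h := S.hLower t
  let θ := S.coframe t
  let η := eta p (Fn d M)
  ∑ B, g.lam B A *
    (F B ![X, Y]
      + extDeriv (h (W B)) X Y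
      + (1 / 2 : ℝ) • ∑ D, wedge (θ D) (differential (h (W D) (W B))) X Y
      + ∑ D, wedge (S.Δ t D B) (h (W D)) X Y
      + ∑ C, ∑ D, ((1 / 2 : ℝ) • ∑ E, ∑ G, η D E * η C G * extDeriv (θ G) (t B) (t E))
          * wedge (h (W D)) (θ C) X Y
      - ∑ C, ∑ D, h (W C) (W D) * wedge (S.Δ t D B) (θ C) X Y)

end PNCStructure

end PNC

end

/-! Fix a longitudinal frame. The longitudinal part `τ^A(∇_X Y)` of a connection in `D₀` is forced:
`∇τ = 0` makes the forms `τ^A(∇τ_B)` antisymmetric once an index is lowered, vanishing torsion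
expresses `dτ^A` through them, and Koszul's trick solves for them (`coframe_conn`). The Augustinian
condition says that the forms `ω^A_B` so obtained satisfy `dτ^A = -ω^A_B ∧ τ^B`
(`IsAugustinian.extDeriv_coframe`). Taking the transverse part from the Koszul form of the
degenerate metric `h` then gives an actual element of `D₀`, and its induced field strength is pure
gauge (`special_isSpecial`).

Adding the tensor built from `F_A` changes the induced field strength by `F_A` up to gauge
(`shifted_gauge`), and an element of `D₀` is determined by the class that it induces
(`eq_of_gauge`). Hence, for each single frame, field strengths correspond bijectively to `D₀`, the
inverse being `D ↦ [F(D)]` (`mapsTo_iff`).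

The set of pairs is therefore frames times `D₀`. The group acts simply transitively on frames
(`existsUnique_act`), so moving the frame and keeping the connection is a right action whose orbits
are the fibres of the map to `D₀`. That (∗) describes this action is one computation modulo gauge
(`cls_inducedForm_act`); well-definedness of (∗) and its composition law are then inherited and need
no separate check.

Tensor fields are `C^∞(M)`-linear maps throughout. Analysis enters through cut-off functions and
local dual bases, which represent `h` by a module map `sharp` whose image is all of `Ker τ`
(`exists_sharp_eq`); the rest is algebra over `C^∞(M)`. -/

noncomputable section

namespace PNC

open Filter Topology

/-! ### Pointwise calculus of smooth functions, vector fields and brackets. -/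

section Calculus

variable {d : ℕ} {M : Type*} [TopologicalSpace M] [ChartedSpace (EuclideanSpace ℝ (Fin d)) M]

theorem Fn.sum_apply {ι : Type*} (s : Finset ι) (f : ι → Fn d M) (q : M) :
    (∑ i ∈ s, f i) q = ∑ i ∈ s, f i q := by
  classical
  induction s using Finset.induction_on with
  | empty => rfl
  | insert a s ha ih => rw [Finset.sum_insert ha, Finset.sum_insert ha, Fn.add_apply, ih]

@[simp] theorem Fn.zero_apply (q : M) : (0 : Fn d M) q = 0 := rfl

@[simp] theorem Fn.one_apply (q : M) : (1 : Fn d M) q = 1 := rfl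

@[simp] theorem Fn.neg_apply (f : Fn d M) (q : M) : (-f) q = -f q := rfl

@[simp] theorem Fn.sub_apply (f g : Fn d M) (q : M) : (f - g) q = f q - g q := rfl

@[simp] theorem Fn.algebraMap_apply (r : ℝ) (q : M) : (algebraMap ℝ (Fn d M) r) q = r := rfl

/-- Evaluation at a point as a ring homomorphism. -/
def Fn.eval (q : M) : Fn d M →+* ℝ where
  toFun f := f q
  map_one' := rfl
  map_mul' _ _ := rfl
  map_zero' := rfl
  map_add' _ _ := rfl

/-- A family of smooth functions, one for each point, which agree at nearby points with the
function attached to a fixed point, glue to a smooth function. -/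
def Fn.glue (f : M → Fn d M) (hf : ∀ q, ∀ᶠ x in 𝓝 q, f x x = f q x) : Fn d M :=
  ⟨fun q => f q q, fun q =>
    ((f q).contMDiff q).congr_of_eventuallyEq (hf q)⟩

theorem Fn.glue_apply (f : M → Fn d M) (hf : ∀ q, ∀ᶠ x in 𝓝 q, f x x = f q x) (q : M) :
    Fn.glue f hf q = f q q := rfl

theorem Fn.continuous (f : Fn d M) : Continuous f := f.contMDiff.continuous

/-- A smooth function without zero at `q` has a smooth inverse near `q`. -/
theorem Fn.exists_eventually_mul_eq_one (f : Fn d M) {q : M} (hq : f q ≠ 0) :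
    ∃ g : Fn d M, ∀ᶠ x in 𝓝 q, g x * f x = 1 := by
  -- The support of this bump on the line stays away from 0, so `x ↦ b x / x` is smooth everywhere
  -- and equals `1 / x` near `f q`; composing it with `f` gives the local inverse.
  let b : ContDiffBump (f q) := ⟨|f q| / 4, |f q| / 2, by positivity, by
    have : 0 < |f q| := abs_pos.mpr hq
    linarith⟩
  have hb : ContDiff ℝ ∞ (fun x : ℝ => b x / x) := by
    rw [contDiff_iff_contDiffAt]
    intro x
    by_cases hx : x = 0
    · have h0 : x ∉ tsupport b := by
        rw [b.tsupport_eq, hx, Metric.mem_closedBall, not_le, dist_comm, Real.dist_eq, sub_zero]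
        have : 0 < |f q| := abs_pos.mpr hq
        change |f q| / 2 < |f q|
        linarith
      have h1 : (fun x : ℝ => b x / x) =ᶠ[𝓝 x] fun _ => 0 := by
        filter_upwards [notMem_tsupport_iff_eventuallyEq.mp h0] with y hy
        rw [hy]
        simp
      exact contDiffAt_const.congr_of_eventuallyEq h1
    · exact b.contDiffAt.div contDiffAt_id hx
  refine ⟨⟨fun x => b (f x) / f x, hb.contMDiff.comp f.contMDiff⟩, ?_⟩
  have h1 : ∀ᶠ x in 𝓝 q, b (f x) = 1 :=
    f.continuous.continuousAt.eventually b.eventuallyEq_one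
  have h2 : ∀ᶠ x in 𝓝 q, f x ≠ 0 := f.continuous.continuousAt.eventually_ne hq
  filter_upwards [h1, h2] with x hx hx'
  change b (f x) / f x * f x = 1
  rw [div_mul_cancel₀ _ hx', hx]

variable [IsManifold (𝓡 d) ∞ M]

theorem VField.add_apply (X Y : VField d M) (q : M) : (X + Y) q = X q + Y q := rfl

theorem VField.sub_apply (X Y : VField d M) (q : M) : (X - Y) q = X q - Y q := rfl

theorem VField.sum_apply {ι : Type*} (s : Finset ι) (f : ι → VField d M) (q : M) :
    (∑ i ∈ s, f i) q = ∑ i ∈ s, f i q := by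
  classical
  induction s using Finset.induction_on with
  | empty => rfl
  | insert a s ha ih => rw [Finset.sum_insert ha, Finset.sum_insert ha, VField.add_apply, ih]

/-- Gluing of vector fields, in analogy with `Fn.glue`. -/
def VField.glue (X : M → VField d M) (hX : ∀ q, ∀ᶠ x in 𝓝 q, X x x = X q x) : VField d M :=
  ⟨fun q => X q q, fun q => by
    refine ((X q).contMDiff q).congr_of_eventuallyEq ?_
    filter_upwards [hX q] with x hx
    rw [hx]⟩

theorem VField.glue_apply (X : M → VField d M) (hX : ∀ q, ∀ᶠ x in 𝓝 q, X x x = X q x) (q : M) :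
    VField.glue X hX q = X q q := rfl

theorem lieDeriv_add_left (X Y : VField d M) (f : Fn d M) :
    lieDeriv (X + Y) f = lieDeriv X f + lieDeriv Y f := by
  ext q
  exact (mfderiv (𝓡 d) 𝓘(ℝ, ℝ) f q).map_add (X q) (Y q)

theorem lieDeriv_smul_left (g : Fn d M) (X : VField d M) (f : Fn d M) :
    lieDeriv (g • X) f = g * lieDeriv X f := by
  ext q
  exact (mfderiv (𝓡 d) 𝓘(ℝ, ℝ) f q).map_smul (g q) (X q)

/-- The differential of a function as a linear map. -/
def differentialForm (f : Fn d M) : OneForm d M where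
  toFun X := lieDeriv X f
  map_add' X Y := lieDeriv_add_left X Y f
  map_smul' g X := lieDeriv_smul_left g X f

/-- The derivative along a vector field as an additive homomorphism. -/
def lieDerivHom (X : VField d M) : Fn d M →+ Fn d M :=
  AddMonoidHom.mk' (lieDeriv X) (lieDeriv_add X)

theorem lieDeriv_zero (X : VField d M) : lieDeriv X 0 = 0 := (lieDerivHom X).map_zero

theorem lieDeriv_neg (X : VField d M) (f : Fn d M) : lieDeriv X (-f) = -lieDeriv X f :=
  (lieDerivHom X).map_neg f

theorem lieDeriv_sum {ι : Type*} (X : VField d M) (s : Finset ι) (f : ι → Fn d M) :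
    lieDeriv X (∑ i ∈ s, f i) = ∑ i ∈ s, lieDeriv X (f i) := map_sum (lieDerivHom X) f s

theorem lieDeriv_one (X : VField d M) : lieDeriv X 1 = 0 := by
  have h := lieDeriv_mul X 1 1
  simp only [one_mul] at h
  simpa using h

theorem bracket_swap (X Y : VField d M) : bracket X Y = -bracket Y X := by
  ext1 q
  exact VectorField.mlieBracket_swap_apply

theorem VField.mdifferentiableAt (X : VField d M) (q : M) :
    MDifferentiableAt (𝓡 d) (𝓡 d).tangent (fun q => (⟨q, X q⟩ : TangentBundle (𝓡 d) M)) q :=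
  X.contMDiff.mdifferentiable (by simp) q

theorem isManifold_two : IsManifold (𝓡 d) 2 M :=
  inferInstance

theorem bracket_add_right (X Y Z : VField d M) : bracket X (Y + Z) = bracket X Y + bracket X Z := by
  have := isManifold_two (d := d) (M := M)
  ext1 q
  exact VectorField.mlieBracket_add_right (Y.mdifferentiableAt q) (Z.mdifferentiableAt q)

theorem bracket_smul_right (X : VField d M) (f : Fn d M) (Y : VField d M) :
    bracket X (f • Y) = lieDeriv X f • Y + f • bracket X Y := by
  have := isManifold_two (d := d) (M := M)
  ext1 q
  exact VectorField.mlieBracket_smul_right (f.contMDiff.mdifferentiable (by simp) q)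
    (Y.mdifferentiableAt q)

theorem bracket_add_left (X Y Z : VField d M) : bracket (X + Y) Z = bracket X Z + bracket Y Z := by
  rw [bracket_swap, bracket_add_right, bracket_swap Z X, bracket_swap Z Y, neg_add, neg_neg,
    neg_neg]

theorem bracket_smul_left (f : Fn d M) (X Y : VField d M) :
    bracket (f • X) Y = -(lieDeriv Y f • X) + f • bracket X Y := by
  rw [bracket_swap, bracket_smul_right, bracket_swap Y X, neg_add, smul_neg, neg_neg]

/-- A system of 1-forms and vector fields which is biorthogonal at `q` can be modified to be
biorthogonal near `q`. -/
theorem exists_eventually_biorthogonal {ι : Type} [Fintype ι] [DecidableEq ι]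
    (E : ι → VField d M) (θ : ι → OneForm d M) {q : M}
    (h : ∀ i j, θ i (E j) q = if i = j then 1 else 0) :
    ∃ a : Matrix ι ι (Fn d M), ∀ᶠ x in 𝓝 q, ∀ i j,
      (∑ k, a i k • θ k) (E j) x = if i = j then 1 else 0 := by
  let A : Matrix ι ι (Fn d M) := fun i j => θ i (E j)
  have hA : A.map (Fn.eval q) = 1 := by
    ext i j
    rw [Matrix.map_apply, Matrix.one_apply]
    exact h i j
  have hdet : A.det q = 1 := by
    have h1 := (Fn.eval q).map_det A
    rw [RingHom.mapMatrix_apply, hA, Matrix.det_one] at h1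
    exact h1
  obtain ⟨g, hg⟩ := A.det.exists_eventually_mul_eq_one (q := q) (by rw [hdet]; exact one_ne_zero)
  -- `g` inverts the determinant only near `q`, so this is the inverse of the pairing matrix there
  -- and merely a smooth matrix elsewhere.
  refine ⟨g • A.adjugate, ?_⟩
  filter_upwards [hg] with x hx i j
  have h2 : (∑ k, (g • A.adjugate) i k • θ k) (E j) = ((g • A.adjugate) * A) i j := by
    rw [Matrix.mul_apply]
    simp [LinearMap.sum_apply, A]
  rw [h2, Matrix.smul_mul, Matrix.adjugate_mul, Matrix.smul_apply, Matrix.smul_apply,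
    Matrix.one_apply, smul_eq_mul, smul_eq_mul, Fn.mul_apply, Fn.mul_apply]
  split_ifs
  · rw [Fn.one_apply, mul_one, hx]
  · rw [Fn.zero_apply, mul_zero, mul_zero]

end Calculus

/-! ### Locality: values of 1-forms at a point and local dual bases. -/

section Locality

variable {d : ℕ} {M : Type*} [TopologicalSpace M] [ChartedSpace (EuclideanSpace ℝ (Fin d)) M]
  [IsManifold (𝓡 d) ∞ M] [T2Space M]

/-- Near each point there are finitely many vector fields, linearly independent at the point,
which generate all vector fields up to a cut-off function. -/
theorem exists_local_generators (q : M) : ∃ (e : Fin d → VField d M) (b : Fn d M), b q = 1 ∧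
    LinearIndependent ℝ (fun i => e i q) ∧
    ∀ X : VField d M, ∃ c : Fin d → Fn d M, b • X = ∑ i, c i • e i := by
  let E := EuclideanSpace ℝ (Fin d)
  let t := trivializationAt E (TangentSpace (𝓡 d) : M → Type _) q
  have hq : q ∈ t.baseSet := FiberBundle.mem_baseSet_trivializationAt E _ q
  let B : Module.Basis (Fin d) ℝ E := (EuclideanSpace.basisFun (Fin d) ℝ).toBasis
  obtain ⟨φ, -, hφ⟩ := (SmoothBumpFunction.nhds_basis_tsupport (I := 𝓡 d) q).mem_iff.mp
    (t.open_baseSet.mem_nhds hq)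
  have hloc : ∀ x, x ∉ t.baseSet → ∀ᶠ y in 𝓝 x, φ y = 0 := fun x hx =>
    notMem_tsupport_iff_eventuallyEq.mp fun h => hx (hφ h)
  have : ContMDiffVectorBundle ∞ E (TangentSpace (𝓡 d) : M → Type _) (𝓡 d) := inferInstance
  let b : Fn d M := ⟨φ, φ.contMDiff⟩
  have hb : ∀ x, b x = φ x := fun _ => rfl
  let e : Fin d → VField d M := fun i => ⟨fun x => φ x • t.localFrame B i x, fun x => by
    by_cases hx : x ∈ t.baseSet
    · exact φ.contMDiff.contMDiffAt.smul_section (contMDiffAt_localFrame_of_mem ∞ t B i hx)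
    · refine ((0 : VField d M).contMDiff x).congr_of_eventuallyEq ?_
      filter_upwards [hloc x hx] with y hy
      rw [hy, zero_smul]
      rfl⟩
  have he : ∀ i x, e i x = φ x • t.localFrame B i x := fun _ _ => rfl
  -- The generators and the coefficients must both be cut off to be globally smooth, so the bump
  -- appears squared.
  refine ⟨e, b * b, ?_, ?_, fun X => ?_⟩
  · rw [Fn.mul_apply, hb, φ.eq_one, one_mul]
  · have h := (t.isLocalFrameOn_localFrame_baseSet (𝓡 d) ∞ B).linearIndependent hq
    simpa only [he, φ.eq_one, one_smul] using h
  · let c : Fin d → Fn d M := fun i => ⟨fun x => φ x • t.localFrameCoeff (𝓡 d) B i x (X x),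
      fun x => by
      by_cases hx : x ∈ t.baseSet
      · exact φ.contMDiff.contMDiffAt.smul (contMDiffAt_localFrameCoeff B hx (X.contMDiff x) i)
      · refine ((0 : Fn d M).contMDiff x).congr_of_eventuallyEq ?_
        filter_upwards [hloc x hx] with y hy
        rw [hy, zero_smul]
        rfl⟩
    have hc : ∀ i x, c i x = φ x * t.localFrameCoeff (𝓡 d) B i x (X x) := fun _ _ => rfl
    refine ⟨c, VField.ext fun x => ?_⟩
    rw [VField.sum_apply, VField.smul_apply, Fn.mul_apply, hb]
    simp only [VField.smul_apply, he, hc]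
    by_cases hx : x ∈ t.baseSet
    · conv_lhs => rw [t.eq_sum_localFrameCoeff_smul (I := 𝓡 d) (b := B) (s := X) hx]
      rw [Finset.smul_sum]
      refine Finset.sum_congr rfl fun i _ => ?_
      rw [smul_smul, smul_smul]
      congr 1
      ring
    · have h0 := (hloc x hx).self_of_nhds
      simp [h0]

/-- The value at a point of `α(X)` depends only on the value of `X` at that point. -/
theorem OneForm.apply_eq_zero (α : OneForm d M) {X : VField d M} {q : M} (hX : X q = 0) :
    α X q = 0 := by
  obtain ⟨e, b, hb, he, h⟩ := exists_local_generators (d := d) q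
  obtain ⟨c, hc⟩ := h X
  -- Independence of the generators at `q` makes the coefficients of `X` vanish there, after which
  -- `C^∞(M)`-linearity of `α` suffices.
  have h1 : ∑ i, c i q • e i q = 0 := by
    have h2 := congrArg (fun Y : VField d M => Y q) hc
    simp only [VField.smul_apply, VField.sum_apply, hX, smul_zero] at h2
    exact h2.symm
  have h3 := Fintype.linearIndependent_iff.mp he _ h1
  have h4 := congrArg (fun Y : VField d M => α Y q) hc
  simpa [Fn.sum_apply, h3, hb] using h4

theorem OneForm.apply_congr (α : OneForm d M) {X Y : VField d M} {q : M} (h : X q = Y q) :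
    α X q = α Y q := by
  rw [← sub_eq_zero, ← Fn.sub_apply, ← map_sub]
  exact α.apply_eq_zero (by rw [VField.sub_apply, h, sub_self])

/-- A biorthogonal system of vector fields and 1-forms at `q` with the right number of elements
consists of bases; in particular it expands vector fields. -/
theorem eq_sum_of_biorthogonal {ι : Type} [Fintype ι] [DecidableEq ι] (hι : Fintype.card ι = d)
    (E : ι → VField d M) (θ : ι → OneForm d M) {q : M}
    (h : ∀ i j, θ i (E j) q = if i = j then 1 else 0) (X : VField d M) :
    X q = ∑ i, θ i X q • E i q := by
  have hE : LinearIndependent ℝ fun i => E i q := by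
    rw [Fintype.linearIndependent_iff]
    intro g hg i
    have h1 := (θ i).apply_eq_zero (X := ∑ j, algebraMap ℝ (Fn d M) (g j) • E j) (q := q)
      (by simpa [VField.sum_apply, VField.smul_apply] using hg)
    simpa [Fn.sum_apply, h] using h1
  have : FiniteDimensional ℝ (TangentSpace (𝓡 d) q) :=
    inferInstanceAs (FiniteDimensional ℝ (EuclideanSpace ℝ (Fin d)))
  have hd : Module.finrank ℝ (TangentSpace (𝓡 d) q) = d := finrank_euclideanSpace_fin (𝕜 := ℝ)
  -- An independent family of the right size is turned into a basis only for a nonempty index type;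
  -- in dimension 0 there is nothing to expand.
  rcases isEmpty_or_nonempty ι with hemp | hne
  · have h0 : Module.finrank ℝ (TangentSpace (𝓡 d) q) = 0 := by rw [hd, ← hι, Fintype.card_eq_zero]
    have := Module.finrank_zero_iff.mp h0
    exact Subsingleton.elim _ _
  let B := basisOfLinearIndependentOfCardEqFinrank hE (hι.trans hd.symm)
  have hB : ∀ i, B i = E i q := fun i => by
    simp [B, coe_basisOfLinearIndependentOfCardEqFinrank]
  have h2 : X q = ∑ i, B.repr (X q) i • E i q := by
    conv_lhs => rw [← B.sum_repr (X q)]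
    simp only [hB]
  have h3 : ∀ i, θ i X q = B.repr (X q) i := by
    intro i
    have h1 := (θ i).apply_congr (X := X)
      (Y := ∑ j, algebraMap ℝ (Fn d M) (B.repr (X q) j) • E j) (q := q)
      (by simpa [VField.sum_apply, VField.smul_apply] using h2)
    simpa [Fn.sum_apply, h] using h1
  simp only [h3]
  exact h2

end Locality

theorem Fn.exists_cutoff {d : ℕ} {M : Type*} [TopologicalSpace M]
    [ChartedSpace (EuclideanSpace ℝ (Fin d)) M] [IsManifold (𝓡 d) ∞ M] [T2Space M] {q : M}
    {U : Set M} (hU : U ∈ 𝓝 q) :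
    ∃ f : Fn d M, (∀ᶠ x in 𝓝 q, f x = 1) ∧ ∀ x, x ∉ U → f x = 0 := by
  obtain ⟨φ, -, hφ⟩ := (SmoothBumpFunction.nhds_basis_tsupport (I := 𝓡 d) q).mem_iff.mp hU
  exact ⟨⟨φ, φ.contMDiff⟩, φ.eventuallyEq_one,
    fun x hx => image_eq_zero_of_notMem_tsupport fun h => hx (hφ h)⟩

/-! ### The map `h^{ab} α_b` and its image, the transverse vector fields. -/

namespace PNCStructure

section Geometry

variable {d p : ℕ} {M : Type*} [TopologicalSpace M]
  [ChartedSpace (EuclideanSpace ℝ (Fin d)) M] [IsManifold (𝓡 d) ∞ M]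

theorem card_index (S : PNCStructure d p M) (q : M) : p + 1 + (d - (p + 1)) = d := by
  obtain ⟨E, ⟨hE, hs⟩, -⟩ := S.τ_signature q
  have h1 := finrank_span_eq_card hE
  rw [hs, finrank_top] at h1
  have hd : Module.finrank ℝ (TangentSpace (𝓡 d) q) = d := finrank_euclideanSpace_fin (𝕜 := ℝ)
  simp only [Fintype.card_sum, Fintype.card_fin] at h1
  omega

variable [T2Space M]

/-- Near each point there are dual bases consisting of globally defined fields. -/
theorem exists_local_dual_bases (S : PNCStructure d p M) (q : M) :
    ∃ (E : Fin (p + 1) ⊕ Fin (d - (p + 1)) → VField d M)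
      (θ : Fin (p + 1) ⊕ Fin (d - (p + 1)) → OneForm d M) (f : Fn d M),
      (∀ᶠ x in 𝓝 q, f x = 1) ∧ ∀ X : VField d M, f • X = ∑ i, (f * θ i X) • E i := by
  obtain ⟨E, θ, -, h, -⟩ := S.h_signature q
  obtain ⟨a, ha⟩ := exists_eventually_biorthogonal E θ h
  obtain ⟨f, hf, hf0⟩ := Fn.exists_cutoff (d := d) ha
  refine ⟨E, fun i => ∑ k, a i k • θ k, f, hf, fun X => VField.ext fun x => ?_⟩
  simp only [VField.smul_apply, VField.sum_apply, mul_smul, ← Finset.smul_sum]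
  by_cases hx : ∀ i j, (∑ k, a i k • θ k) (E j) x = if i = j then 1 else 0
  · rw [← eq_sum_of_biorthogonal (by simp [S.card_index q]) E _ hx X]
  · rw [hf0 x hx, zero_smul, zero_smul]

/-- The structure `S` serves here as a supplier of globally defined dual bases near each point;
these make global 1-forms separate tangent vectors. -/
theorem eq_of_oneForm_apply_eq (S : PNCStructure d p M) {X Y : VField d M} {q : M}
    (h : ∀ β : OneForm d M, β X q = β Y q) : X q = Y q := by
  obtain ⟨E, θ, f, hf, hE⟩ := S.exists_local_dual_bases q
  have h1 : ∀ Z : VField d M, Z q = ∑ i, θ i Z q • E i q := fun Z => by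
    have := congrArg (fun Z : VField d M => Z q) (hE Z)
    simpa only [VField.smul_apply, VField.sum_apply, Fn.mul_apply, hf.self_of_nhds, one_smul,
      one_mul] using this
  rw [h1 X, h1 Y]
  simp only [h]

theorem ext_oneForm (S : PNCStructure d p M) {X Y : VField d M}
    (h : ∀ β : OneForm d M, β X = β Y) : X = Y :=
  VField.ext fun _ => S.eq_of_oneForm_apply_eq fun β => by rw [h]

/-- In a local dual basis the vector field must be `∑ Φ(θ_i) E_i`. The neighbourhood does not depend
on `β`, which is what allows the local solutions to be glued in `exists_eval_eq`. -/
theorem exists_local_eval_eq (S : PNCStructure d p M) (Φ : OneForm d M →ₗ[Fn d M] Fn d M)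
    (q : M) : ∃ X : VField d M, ∀ᶠ x in 𝓝 q, ∀ β : OneForm d M, β X x = Φ β x := by
  obtain ⟨E, θ, f, hf, hE⟩ := S.exists_local_dual_bases q
  refine ⟨∑ i, Φ (θ i) • E i, ?_⟩
  filter_upwards [hf] with x hx β
  have h1 : f • β = ∑ i, (f * β (E i)) • θ i := by
    refine LinearMap.ext fun X => ?_
    rw [LinearMap.smul_apply, ← map_smul, hE, map_sum, LinearMap.sum_apply]
    refine Finset.sum_congr rfl fun i _ => ?_
    rw [map_smul, LinearMap.smul_apply, smul_eq_mul, smul_eq_mul]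
    ring
  have h2 := congrArg (fun α => Φ α x) h1
  simp only [map_smul, map_sum, smul_eq_mul, Fn.mul_apply, hx, Fn.sum_apply, one_mul] at h2
  rw [h2, map_sum, Fn.sum_apply]
  refine Finset.sum_congr rfl fun i _ => ?_
  rw [map_smul, smul_eq_mul, Fn.mul_apply, mul_comm]

/-- The module of vector fields is reflexive. -/
theorem exists_eval_eq (S : PNCStructure d p M) (Φ : OneForm d M →ₗ[Fn d M] Fn d M) :
    ∃ X : VField d M, ∀ β : OneForm d M, β X = Φ β := by
  choose X hX using S.exists_local_eval_eq Φ
  have hloc : ∀ q, ∀ᶠ x in 𝓝 q, X x x = X q x := fun q => (hX q).mono fun x hx =>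
    S.eq_of_oneForm_apply_eq fun β => by rw [hx, (hX x).self_of_nhds]
  refine ⟨VField.glue X hloc, fun β => Fn.ext fun q => ?_⟩
  rw [β.apply_congr (VField.glue_apply X hloc q), (hX q).self_of_nhds]

end Geometry

variable {d p : ℕ} {M : Type*} [TopologicalSpace M]
  [ChartedSpace (EuclideanSpace ℝ (Fin d)) M] [IsManifold (𝓡 d) ∞ M] [T2Space M]
  (S : PNCStructure d p M)

/-- The vector field `h^{ab} α_b`. -/
def sharp : OneForm d M →ₗ[Fn d M] VField d M where
  toFun α := (S.exists_eval_eq (S.h.flip α)).choose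
  map_add' α β := S.ext_oneForm fun ψ => by
    have H := fun α => (S.exists_eval_eq (S.h.flip α)).choose_spec ψ
    rw [ψ.map_add, H, H, H, map_add, LinearMap.add_apply]
  map_smul' f α := S.ext_oneForm fun ψ => by
    have H := fun α => (S.exists_eval_eq (S.h.flip α)).choose_spec ψ
    rw [ψ.map_smul, H, H, map_smul, LinearMap.smul_apply, RingHom.id_apply]

theorem apply_sharp (β α : OneForm d M) : β (S.sharp α) = S.h β α :=
  (S.exists_eval_eq (S.h.flip α)).choose_spec β

theorem sharp_τ (X : VField d M) : S.sharp (S.τ X) = 0 :=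
  S.ext_oneForm fun β => by rw [apply_sharp, S.orthogonal, map_zero]

theorem sharp_mem_ker (α : OneForm d M) : S.sharp α ∈ S.Ker := by
  refine LinearMap.ext fun X => ?_
  rw [S.τ_symm, apply_sharp, S.h_symm, S.orthogonal]
  rfl

omit [T2Space M] in
theorem τ_left_of_mem {V : VField d M} (hV : V ∈ S.Ker) (X : VField d M) : S.τ V X = 0 := by
  have h : S.τ V = 0 := hV
  rw [h]
  rfl

omit [T2Space M] in
theorem τ_right_of_mem {V : VField d M} (hV : V ∈ S.Ker) (X : VField d M) : S.τ X V = 0 := by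
  rw [S.τ_symm, S.τ_left_of_mem hV]

omit [T2Space M] in
theorem coframe_of_mem (t : Fin (p + 1) → VField d M) (A : Fin (p + 1)) {V : VField d M}
    (hV : V ∈ S.Ker) : S.coframe t A V = 0 := by
  simp [coframe, LinearMap.sum_apply, S.τ_right_of_mem hV]

theorem sharp_coframe (t : Fin (p + 1) → VField d M) (A : Fin (p + 1)) :
    S.sharp (S.coframe t A) = 0 := by
  simp [coframe, S.sharp_τ]

variable (t : S.LongitudinalFrame)

/-- The projector onto transverse vector fields, as a linear map. -/
def projHom : VField d M →ₗ[Fn d M] VField d M :=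
  LinearMap.id - ∑ A, (S.coframe t A).smulRight (t A)

omit [T2Space M] in
theorem projHom_apply (X : VField d M) : S.projHom t X = S.proj t X := by
  simp [projHom, proj, LinearMap.sum_apply]

omit [T2Space M] in
theorem coframe_proj (A : Fin (p + 1)) (X : VField d M) : S.coframe t A (S.proj t X) = 0 := by
  simp [proj, S.coframe_apply]

omit [T2Space M] in
theorem τ_frame (A : Fin (p + 1)) (X : VField d M) :
    S.τ (t A) X = ∑ B, eta p (Fn d M) A B * S.coframe t B X := by
  simp only [coframe, LinearMap.sum_apply, LinearMap.smul_apply, smul_eq_mul, Finset.mul_sum]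
  rw [Finset.sum_comm]
  simp only [← mul_assoc, ← Finset.sum_mul, sum_eta_mul_eta]
  simp

omit [T2Space M] in
theorem proj_of_mem {V : VField d M} (hV : V ∈ S.Ker) : S.proj t V = V := by
  simp [proj, S.coframe_of_mem t _ hV]

/-- A local frame of transverse vector fields of the form `h^{ab} θ_b`. -/
theorem exists_local_sharp_basis (q : M) :
    ∃ (θ ψ : Fin (d - (p + 1)) → OneForm d M), ∀ᶠ x in 𝓝 q, ∀ X : VField d M,
      X x = ∑ A, S.coframe t A X x • t A x + ∑ i, ψ i X x • S.sharp (θ i) x := by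
  obtain ⟨E, θ, -, -, h, -⟩ := S.h_signature q
  let e : Fin (d - (p + 1)) → VField d M := fun i => S.sharp (θ (Sum.inr i))
  obtain ⟨a, ha⟩ := exists_eventually_biorthogonal e (fun i => θ (Sum.inr i)) (q := q)
    (fun i j => by rw [S.apply_sharp]; exact h i j)
  let ψ : Fin (d - (p + 1)) → OneForm d M := fun i => ∑ k, a i k • θ (Sum.inr k)
  refine ⟨fun i => θ (Sum.inr i), fun i => ψ i ∘ₗ S.projHom t, ?_⟩
  filter_upwards [ha] with x hx X
  -- The frame contributes `p + 1` vectors and the `h^{ab} θ_b` contribute `d - p - 1`. Composing `ψ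
  -- i` with the projector makes it vanish on the frame, so the whole system is biorthogonal with
  -- exactly `d` members.
  have h1 := eq_sum_of_biorthogonal (by simp [S.card_index q]) (Sum.elim t.vec e)
    (Sum.elim (S.coframe t) fun i => ψ i ∘ₗ S.projHom t) (q := x) ?_ X
  · rw [h1, Fintype.sum_sum_type]
    rfl
  · rintro (A | i) (B | j)
    · simp only [Sum.elim_inl, S.coframe_apply, Sum.inl.injEq]
      split_ifs <;> rfl
    · simp only [Sum.elim_inl, Sum.elim_inr]
      rw [S.coframe_of_mem t A (S.sharp_mem_ker _)]
      simp
    · have h0 : S.projHom t (t B) = 0 := by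
        simp [projHom_apply, proj, S.coframe_apply]
      simp [h0]
    · simp only [Sum.elim_inr, LinearMap.comp_apply, Sum.inr.injEq]
      rw [projHom_apply, S.proj_of_mem t (S.sharp_mem_ker _)]
      exact hx i j

/-- That every `τ^A` annihilates `P X` is pure algebra, but membership in the kernel of `τ` uses the
ranks: by dimension count the complement of the frame is spanned at each point by vectors `h^{ab}
θ_b`, all of which are transverse. -/
theorem proj_mem_ker (X : VField d M) : S.proj t X ∈ S.Ker := by
  refine LinearMap.ext fun Y => Fn.ext fun q => ?_
  obtain ⟨θ, ψ, h⟩ := S.exists_local_sharp_basis t q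
  have h1 := OneForm.apply_congr (S.τ Y) (X := S.proj t X)
    (Y := ∑ i, ψ i X • S.sharp (θ i)) (q := q) (by
    rw [proj, VField.sub_apply, h.self_of_nhds X]
    simp [VField.sum_apply, VField.smul_apply])
  rw [S.τ_symm, h1]
  simp [S.τ_right_of_mem (S.sharp_mem_ker _)]

/-- Precomposing with `P` alters `α` by multiples of the co-frame, which `sharp` kills. The
normalisation `α = α ∘ P` removes exactly the ambiguity in `α`, so that local solutions can be
glued. -/
theorem exists_local_sharp_eq {V : VField d M} (hV : V ∈ S.Ker) (q : M) :
    ∃ α : OneForm d M, (∀ X, α X = α (S.proj t X)) ∧ ∀ᶠ x in 𝓝 q, S.sharp α x = V x := by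
  obtain ⟨θ, ψ, h⟩ := S.exists_local_sharp_basis t q
  have hp : ∀ α : OneForm d M, α ∘ₗ S.projHom t = α - ∑ A, α (t A) • S.coframe t A := by
    intro α
    refine LinearMap.ext fun X => ?_
    simp [projHom, LinearMap.sum_apply, mul_comm]
  refine ⟨(∑ i, ψ i V • θ i) ∘ₗ S.projHom t, fun X => ?_, ?_⟩
  · rw [LinearMap.comp_apply, LinearMap.comp_apply, projHom_apply, projHom_apply]
    congr 1
    simp [proj, S.coframe_apply]
  · filter_upwards [h] with x hx
    rw [hp, map_sub, map_sum, hx V]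
    simp [S.sharp_coframe, S.coframe_of_mem _ _ hV, VField.sum_apply, VField.smul_apply]

/-- Every transverse vector field is of the form `h^{ab} α_b`. -/
theorem exists_sharp_eq (t : S.LongitudinalFrame) {V : VField d M} (hV : V ∈ S.Ker) :
    ∃ α : OneForm d M, S.sharp α = V := by
  choose α hα hαV using S.exists_local_sharp_eq t hV
  -- By the normalisation only transverse arguments matter, and these are locally of the form `sharp
  -- ψ`; symmetry of `h` gives `α(sharp ψ) = ψ(sharp α) = ψ(V)`, which no longer involves the choice
  -- of `α`.
  have hloc : ∀ q, ∀ᶠ x in 𝓝 q, ∀ X, α x X x = α q X x := by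
    intro q
    filter_upwards [hαV q] with x hx X
    obtain ⟨ψ, -, hψ⟩ := S.exists_local_sharp_eq t (V := S.proj t X) (S.proj_mem_ker t X) x
    rw [hα, hα q, ← (α x).apply_congr hψ.self_of_nhds, ← (α q).apply_congr hψ.self_of_nhds,
      S.apply_sharp, S.apply_sharp, S.h_symm, ← S.apply_sharp, S.h_symm, ← S.apply_sharp]
    exact ψ.apply_congr (by rw [hx, (hαV x).self_of_nhds])
  let β : OneForm d M :=
    { toFun X := Fn.glue (fun q => α q X) fun q => (hloc q).mono fun x hx => hx X
      map_add' X Y := Fn.ext fun q => by simp [Fn.glue_apply]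
      map_smul' f X := Fn.ext fun q => by simp [Fn.glue_apply] }
  have hβ : ∀ q X, β X q = α q X q := fun _ _ => rfl
  refine ⟨β, S.ext_oneForm fun φ => Fn.ext fun q => ?_⟩
  rw [S.apply_sharp, S.h_symm, ← S.apply_sharp, hβ, S.apply_sharp, S.h_symm, ← S.apply_sharp]
  exact φ.apply_congr (hαV q).self_of_nhds

end PNCStructure

/-! ### Halves and signs in the function ring; exterior derivatives and 2-forms as multilinear maps.
-/

section Forms

variable {d : ℕ} {M : Type*} [TopologicalSpace M] [ChartedSpace (EuclideanSpace ℝ (Fin d)) M]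

/-- The constant function `1/2`. -/
def Fn.half : Fn d M := algebraMap ℝ (Fn d M) (1 / 2)

/-- The function ring is not a field, so `ring` cannot divide by 2. This identity, like
`sgn_mul_self` for the signs, is fed to `linear_combination` instead. -/
theorem Fn.two_mul_half : (2 : Fn d M) * Fn.half = 1 := by
  have h : (2 : Fn d M) = algebraMap ℝ (Fn d M) 2 := (map_ofNat (algebraMap ℝ (Fn d M)) 2).symm
  rw [h, Fn.half, ← map_mul]
  norm_num

theorem Fn.half_smul (f : Fn d M) : (1 / 2 : ℝ) • f = Fn.half * f := Algebra.smul_def _ _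

theorem Fn.eq_zero_of_add_self {f : Fn d M} (h : f + f = 0) : f = 0 := by
  linear_combination (Fn.half : Fn d M) * h - f * Fn.two_mul_half (d := d) (M := M)

/-- The sign `η_{AA}`. -/
def sgn {p : ℕ} (d : ℕ) (M : Type*) [TopologicalSpace M]
    [ChartedSpace (EuclideanSpace ℝ (Fin d)) M] (A : Fin (p + 1)) : Fn d M :=
  if A = 0 then -1 else 1

theorem sgn_mul_self {p : ℕ} (A : Fin (p + 1)) : sgn d M A * sgn d M A = 1 := by
  unfold sgn
  split_ifs <;> simp

theorem eta_apply {p : ℕ} (A B : Fin (p + 1)) :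
    eta p (Fn d M) A B = if A = B then sgn d M A else 0 := Matrix.diagonal_apply _ _ _

variable [IsManifold (𝓡 d) ∞ M]

theorem lieDeriv_sgn_mul {p : ℕ} (X : VField d M) (A : Fin (p + 1)) (f : Fn d M) :
    lieDeriv X (sgn d M A * f) = sgn d M A * lieDeriv X f := by
  unfold sgn
  split_ifs
  · rw [neg_one_mul, neg_one_mul, lieDeriv_neg]
  · rw [one_mul, one_mul]

/-- The exterior derivative of a 1-form as a bilinear map. -/
def extDerivForm (α : OneForm d M) : VField d M →ₗ[Fn d M] VField d M →ₗ[Fn d M] Fn d M :=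
  LinearMap.mk₂ (Fn d M) (extDeriv α)
    (fun X Y Z => by
      simp only [extDeriv, lieDeriv_add_left, map_add, lieDeriv_add, bracket_add_left]
      ring)
    (fun f X Y => by
      simp only [extDeriv, lieDeriv_smul_left, map_smul, map_add, map_neg, smul_eq_mul,
        lieDeriv_mul, bracket_smul_left]
      ring)
    (fun X Y Z => by
      simp only [extDeriv, lieDeriv_add_left, map_add, lieDeriv_add, bracket_add_right]
      ring)
    (fun f X Y => by
      simp only [extDeriv, lieDeriv_smul_left, map_smul, map_add, smul_eq_mul,
        lieDeriv_mul, bracket_smul_right]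
      ring)

theorem extDerivForm_apply (α : OneForm d M) (X Y : VField d M) :
    extDerivForm α X Y = extDeriv α X Y := rfl

theorem extDeriv_swap (α : OneForm d M) (X Y : VField d M) :
    extDeriv α X Y = -extDeriv α Y X := by
  rw [extDeriv, extDeriv, bracket_swap X Y, map_neg]
  ring

/-- The 2-form attached to an alternating bilinear map. -/
def TwoForm.mk (B : VField d M →ₗ[Fn d M] VField d M →ₗ[Fn d M] Fn d M)
    (hB : ∀ X, B X X = 0) : TwoForm d M where
  toFun v := B (v 0) (v 1)
  map_update_add' v i X Y := by
    fin_cases i <;> simp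
  map_update_smul' v i f X := by
    fin_cases i <;> simp
  map_eq_zero_of_eq' v i j hv hij := by
    have h : v 0 = v 1 := by
      fin_cases i <;> fin_cases j <;> simp_all
    rw [h]
    exact hB _

theorem TwoForm.mk_apply (B : VField d M →ₗ[Fn d M] VField d M →ₗ[Fn d M] Fn d M)
    (hB : ∀ X, B X X = 0) (X Y : VField d M) : TwoForm.mk B hB ![X, Y] = B X Y := rfl

theorem TwoForm.add_left (F : TwoForm d M) (X Y Z : VField d M) :
    F ![X + Y, Z] = F ![X, Z] + F ![Y, Z] := by
  exact F.toMultilinearMap.cons_add ![Z] X Y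

theorem TwoForm.smul_left (F : TwoForm d M) (f : Fn d M) (X Z : VField d M) :
    F ![f • X, Z] = f * F ![X, Z] := by
  exact F.toMultilinearMap.cons_smul ![Z] f X

theorem TwoForm.swap (F : TwoForm d M) (X Y : VField d M) : F ![X, Y] = -F ![Y, X] := by
  have h := F.map_swap ![Y, X] (i := 0) (j := 1) (by simp)
  rw [← h]
  congr 1
  funext i
  fin_cases i <;> rfl

/-- The contraction of a 2-form with a vector field, as a linear map. -/
def contractHom (F : TwoForm d M) : VField d M →ₗ[Fn d M] OneForm d M where
  toFun := contract F
  map_add' X Y := LinearMap.ext fun Z => by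
    rw [LinearMap.add_apply]
    simp only [contract_apply, F.add_left]
  map_smul' f X := LinearMap.ext fun Z => by
    rw [LinearMap.smul_apply]
    simp only [contract_apply, F.smul_left]
    rfl

end Forms

/-! ### The transverse metric `γ` and the tensor `h_{ab}` of a frame. -/

namespace PNCStructure

variable {d p : ℕ} {M : Type*} [TopologicalSpace M]
  [ChartedSpace (EuclideanSpace ℝ (Fin d)) M] [IsManifold (𝓡 d) ∞ M]
  (S : PNCStructure d p M)

theorem coframe_eq (t : Fin (p + 1) → VField d M) (A : Fin (p + 1)) :
    S.coframe t A = sgn d M A • S.τ (t A) := by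
  simp [coframe, eta_apply]

theorem frame_expand (t : S.LongitudinalFrame) (X : VField d M) :
    X = ∑ A, S.coframe t A X • t A + S.proj t X := by
  simp [proj]

variable [T2Space M]

/-- `γ` was defined through a chosen preimage under `sharp`. The choice is irrelevant because `W` is
itself some `sharp φ`, and `α(sharp φ) = φ(sharp α)` depends on `α` only through `sharp α`. -/
theorem γ_sharp (t : S.LongitudinalFrame) (α : OneForm d M) {W : VField d M} (hW : W ∈ S.Ker) :
    S.γ (S.sharp α) W = α W := by
  have H : ∃ ψ : OneForm d M, ∀ β : OneForm d M, β (S.sharp α) = S.h β ψ :=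
    ⟨α, fun β => S.apply_sharp β α⟩
  obtain ⟨φ, rfl⟩ := S.exists_sharp_eq t hW
  rw [γ, dif_pos H, S.apply_sharp, S.h_symm, ← H.choose_spec, S.apply_sharp, S.apply_sharp,
    S.h_symm]

theorem γ_symm (t : S.LongitudinalFrame) {V W : VField d M} (hV : V ∈ S.Ker)
    (hW : W ∈ S.Ker) : S.γ V W = S.γ W V := by
  obtain ⟨α, rfl⟩ := S.exists_sharp_eq t hV
  obtain ⟨β, rfl⟩ := S.exists_sharp_eq t hW
  rw [S.γ_sharp t _ hW, S.γ_sharp t _ hV, S.apply_sharp, S.apply_sharp, S.h_symm]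

theorem γ_add_right (t : S.LongitudinalFrame) {V W W' : VField d M} (hV : V ∈ S.Ker)
    (hW : W ∈ S.Ker) (hW' : W' ∈ S.Ker) :
    S.γ V (W + W') = S.γ V W + S.γ V W' := by
  obtain ⟨α, rfl⟩ := S.exists_sharp_eq t hV
  rw [S.γ_sharp t _ hW, S.γ_sharp t _ hW', S.γ_sharp t _ (S.Ker.add_mem hW hW'), map_add]

theorem γ_smul_right (t : S.LongitudinalFrame) (f : Fn d M) {V W : VField d M}
    (hV : V ∈ S.Ker) (hW : W ∈ S.Ker) :
    S.γ V (f • W) = f • S.γ V W := by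
  obtain ⟨α, rfl⟩ := S.exists_sharp_eq t hV
  rw [S.γ_sharp t _ hW, S.γ_sharp t _ (S.Ker.smul_mem f hW), map_smul]

variable (t : S.LongitudinalFrame)

theorem hLower_symm (X Y : VField d M) : S.hLower t X Y = S.hLower t Y X :=
  S.γ_symm t (S.proj_mem_ker t X) (S.proj_mem_ker t Y)

theorem hLower_add_right (X Y Z : VField d M) :
    S.hLower t X (Y + Z) = S.hLower t X Y + S.hLower t X Z := by
  rw [hLower, ← projHom_apply S t (Y + Z), map_add, projHom_apply, projHom_apply,
    S.γ_add_right t (S.proj_mem_ker t X) (S.proj_mem_ker t Y) (S.proj_mem_ker t Z)]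
  rfl

theorem hLower_smul_right (f : Fn d M) (X Y : VField d M) :
    S.hLower t X (f • Y) = f • S.hLower t X Y := by
  rw [hLower, ← projHom_apply S t (f • Y), map_smul, projHom_apply,
    S.γ_smul_right t f (S.proj_mem_ker t X) (S.proj_mem_ker t Y)]
  rfl

/-- The field `h_{ab}` of a longitudinal frame as a bilinear form. -/
def hForm : VField d M →ₗ[Fn d M] VField d M →ₗ[Fn d M] Fn d M :=
  LinearMap.mk₂ (Fn d M) (S.hLower t)
    (fun X Y Z => by
      rw [S.hLower_symm, hLower_add_right, S.hLower_symm t Z, S.hLower_symm t Z])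
    (fun f X Y => by rw [S.hLower_symm, hLower_smul_right, S.hLower_symm t Y])
    (S.hLower_add_right t) (S.hLower_smul_right t)

theorem hLower_eq (X Y : VField d M) : S.hLower t X Y = S.hForm t X Y := rfl

theorem hForm_symm (X Y : VField d M) : S.hForm t X Y = S.hForm t Y X := S.hLower_symm t X Y

theorem hForm_of_mem {V W : VField d M} (hV : V ∈ S.Ker) (hW : W ∈ S.Ker) :
    S.hForm t V W = S.γ V W := by
  rw [← hLower_eq, hLower, S.proj_of_mem t hV, S.proj_of_mem t hW]

omit [T2Space M] in
theorem proj_frame (A : Fin (p + 1)) : S.proj t (t A) = 0 := by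
  simp [proj, S.coframe_apply]

theorem hForm_proj_left (X Y : VField d M) : S.hForm t (S.proj t X) Y = S.hForm t X Y := by
  rw [← hLower_eq, hLower, S.proj_of_mem t (S.proj_mem_ker t X)]
  rfl

@[simp] theorem hForm_frame_left (A : Fin (p + 1)) (Y : VField d M) : S.hForm t (t A) Y = 0 := by
  rw [← hForm_proj_left, proj_frame, map_zero, LinearMap.zero_apply]

@[simp] theorem hForm_frame_right (A : Fin (p + 1)) (X : VField d M) : S.hForm t X (t A) = 0 := by
  rw [hForm_symm, hForm_frame_left]

theorem hForm_sharp (α : OneForm d M) {W : VField d M} (hW : W ∈ S.Ker) :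
    S.hForm t (S.sharp α) W = α W := by
  rw [S.hForm_of_mem t (S.sharp_mem_ker α) hW, S.γ_sharp t α hW]

/-- Nondegeneracy: pairing `V` with `W = sharp β` gives back `β(V)`, and 1-forms separate vector
fields. -/
theorem eq_zero_of_hForm {V : VField d M} (hV : V ∈ S.Ker)
    (h : ∀ W ∈ S.Ker, S.hForm t V W = 0) : V = 0 := by
  obtain ⟨α, rfl⟩ := S.exists_sharp_eq t hV
  refine S.ext_oneForm fun β => ?_
  rw [S.apply_sharp, S.h_symm, ← S.apply_sharp, ← S.hForm_sharp t α (S.sharp_mem_ker β),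
    h _ (S.sharp_mem_ker β), map_zero]

/-- A vector field is determined by its longitudinal and transverse components. -/
theorem ext_frame {X Y : VField d M} (h1 : ∀ A, S.coframe t A X = S.coframe t A Y)
    (h2 : ∀ W ∈ S.Ker, S.hForm t X W = S.hForm t Y W) : X = Y := by
  have h3 : S.proj t (X - Y) = X - Y := by
    simp [proj, h1]
  have h4 : X - Y = 0 := by
    rw [← h3]
    refine S.eq_zero_of_hForm t (S.proj_mem_ker t _) fun W hW => ?_
    rw [hForm_proj_left, map_sub, LinearMap.sub_apply, h2 W hW, sub_self]
  exact sub_eq_zero.mp h4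

/-- A linear map is determined by its values on a longitudinal frame and on transverse fields. -/
theorem linearMap_ext_frame {N : Type*} [AddCommGroup N] [Module (Fn d M) N]
    {f g : VField d M →ₗ[Fn d M] N} (h1 : ∀ A, f (t A) = g (t A))
    (h2 : ∀ V ∈ S.Ker, f V = g V) : f = g := by
  refine LinearMap.ext fun X => ?_
  rw [S.frame_expand t X]
  simp only [map_add, map_sum, map_smul, h1, h2 _ (S.proj_mem_ker t X)]

theorem τ_eq (X Y : VField d M) :
    S.τ X Y = ∑ A, sgn d M A * (S.coframe t A X * S.coframe t A Y) := by
  have h : S.τ X Y = ∑ A, S.coframe t A X * S.τ (t A) Y := by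
    conv_lhs => rw [S.frame_expand t X]
    simp [LinearMap.sum_apply, S.τ_left_of_mem (S.proj_mem_ker t X)]
  rw [h]
  refine Finset.sum_congr rfl fun A _ => ?_
  rw [coframe_eq, LinearMap.smul_apply, LinearMap.smul_apply, smul_eq_mul, smul_eq_mul]
  linear_combination (-(sgn d M A * S.τ (t A) X * S.τ (t A) Y)) * sgn_mul_self (d := d) (M := M) A

end PNCStructure

section Forms

variable {d : ℕ} {M : Type*} [TopologicalSpace M] [ChartedSpace (EuclideanSpace ℝ (Fin d)) M]
  [IsManifold (𝓡 d) ∞ M]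

/-- The wedge product of 1-forms as a bilinear map. -/
def wedgeForm (α β : OneForm d M) : VField d M →ₗ[Fn d M] VField d M →ₗ[Fn d M] Fn d M :=
  α.smulRight β - β.smulRight α

theorem wedgeForm_apply (α β : OneForm d M) (X Y : VField d M) :
    wedgeForm α β X Y = wedge α β X Y := by
  simp [wedgeForm, wedge, mul_comm]

/-- The covariant derivative along a vector field as an additive homomorphism. -/
def Connection.rightHom (D : Connection d M) (X : VField d M) : VField d M →+ VField d M :=
  AddMonoidHom.mk' (D X) (D.add_right X)

theorem Connection.sum_right {ι : Type*} (D : Connection d M) (X : VField d M) (s : Finset ι)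
    (Y : ι → VField d M) : D X (∑ i ∈ s, Y i) = ∑ i ∈ s, D X (Y i) := map_sum (D.rightHom X) Y s

/-- The covariant derivative of a vector field as a linear map. -/
def Connection.leftHom (D : Connection d M) (Y : VField d M) :
    VField d M →ₗ[Fn d M] VField d M where
  toFun X := D X Y
  map_add' X X' := D.add_left X X' Y
  map_smul' f X := D.smul_left f X Y

theorem Connection.bracket_eq {D : Connection d M} (ht : ∀ X Y, D.torsion X Y = 0)
    (X Y : VField d M) : bracket X Y = D X Y - D Y X :=
  (sub_eq_zero.mp (ht X Y)).symm

end Forms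

/-! ### Connection forms and the longitudinal part of a compatible torsion-free connection. -/

namespace PNCStructure

variable {d p : ℕ} {M : Type*} [TopologicalSpace M]
  [ChartedSpace (EuclideanSpace ℝ (Fin d)) M] [IsManifold (𝓡 d) ∞ M]
  (S : PNCStructure d p M)

theorem IsCompatible.mem_ker {S : PNCStructure d p M} {D : Connection d M}
    (hc : S.IsCompatible D) (X : VField d M) {V : VField d M} (hV : V ∈ S.Ker) :
    D X V ∈ S.Ker := by
  refine LinearMap.ext fun Z => ?_
  have h := hc.1 X V Z
  rw [S.τ_left_of_mem hV, S.τ_left_of_mem hV, lieDeriv_zero] at h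
  rw [LinearMap.zero_apply]
  linear_combination -h

/-- The connection 1-forms `τ^A(∇ τ_B)` of a longitudinal frame, which are common to all
compatible torsion-free connections. -/
def connForm (t : S.LongitudinalFrame) (A B : Fin (p + 1)) : OneForm d M :=
  (Fn.half : Fn d M) • (extDerivForm (S.coframe t A) (t B)
    - (sgn d M A * sgn d M B) • extDerivForm (S.coframe t B) (t A)
    - ∑ D, (sgn d M A * sgn d M D * extDeriv (S.coframe t D) (t A) (t B)) • S.coframe t D)

theorem connForm_apply (t : S.LongitudinalFrame) (A B : Fin (p + 1)) (X : VField d M) :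
    S.connForm t A B X = Fn.half * (extDeriv (S.coframe t A) (t B) X
      - sgn d M A * sgn d M B * extDeriv (S.coframe t B) (t A) X
      - ∑ D, sgn d M A * sgn d M D * extDeriv (S.coframe t D) (t A) (t B) * S.coframe t D X) := by
  simp [connForm, LinearMap.sum_apply, extDerivForm_apply]

theorem sgn_mul_connForm (t : S.LongitudinalFrame) (A B : Fin (p + 1)) (X : VField d M) :
    sgn d M A * S.connForm t A B X = Fn.half * (sgn d M A * extDeriv (S.coframe t A) (t B) X
      - sgn d M B * extDeriv (S.coframe t B) (t A) X
      - ∑ D, sgn d M D * extDeriv (S.coframe t D) (t A) (t B) * S.coframe t D X) := by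
  have h : ∑ D, sgn d M A * sgn d M D * extDeriv (S.coframe t D) (t A) (t B) * S.coframe t D X
      = sgn d M A
        * ∑ D, sgn d M D * extDeriv (S.coframe t D) (t A) (t B) * S.coframe t D X := by
    rw [Finset.mul_sum]
    exact Finset.sum_congr rfl fun D _ => by ring
  rw [connForm_apply, h]
  linear_combination (-Fn.half * (sgn d M B * extDeriv (S.coframe t B) (t A) X
    + ∑ D, sgn d M D * extDeriv (S.coframe t D) (t A) (t B) * S.coframe t D X))
    * sgn_mul_self (d := d) (M := M) A

theorem connForm_antisymm (t : S.LongitudinalFrame) (A B : Fin (p + 1)) (X : VField d M) :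
    sgn d M A * S.connForm t A B X = -(sgn d M B * S.connForm t B A X) := by
  rw [sgn_mul_connForm, sgn_mul_connForm]
  have h : ∑ D, sgn d M D * extDeriv (S.coframe t D) (t A) (t B) * S.coframe t D X
      = -∑ D, sgn d M D * extDeriv (S.coframe t D) (t B) (t A) * S.coframe t D X := by
    rw [← Finset.sum_neg_distrib]
    exact Finset.sum_congr rfl fun D _ => by rw [extDeriv_swap _ (t A) (t B)]; ring
  rw [h]
  ring

theorem lieDeriv_sgn (X : VField d M) (A : Fin (p + 1)) : lieDeriv X (sgn d M A) = 0 := by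
  rw [← mul_one (sgn d M A), lieDeriv_sgn_mul, lieDeriv_one, mul_zero]

theorem lieDeriv_eta (X : VField d M) (A B : Fin (p + 1)) :
    lieDeriv X (eta p (Fn d M) A B) = 0 := by
  rw [eta_apply]
  split_ifs
  · exact lieDeriv_sgn X A
  · exact lieDeriv_zero X

theorem lieDeriv_coframe_frame (t : S.LongitudinalFrame) (X : VField d M) (A B : Fin (p + 1)) :
    lieDeriv X (S.coframe t A (t B)) = 0 := by
  rw [S.coframe_apply]
  split_ifs
  · exact lieDeriv_one X
  · exact lieDeriv_zero X

variable [T2Space M] (t : S.LongitudinalFrame)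

/-- `∇τ = 0` makes `Ker τ` parallel, so the transverse part of `Y` contributes nothing. -/
theorem coframe_conn_expand {D : Connection d M} (hc : S.IsCompatible D) (A : Fin (p + 1))
    (X Y : VField d M) : S.coframe t A (D X Y) = lieDeriv X (S.coframe t A Y)
      + ∑ B, S.coframe t A (D X (t B)) * S.coframe t B Y := by
  conv_lhs => rw [S.frame_expand t Y, D.add_right, D.sum_right, map_add, map_sum,
    S.coframe_of_mem t A (hc.mem_ker X (S.proj_mem_ker t Y)), add_zero]
  simp only [D.leibniz, map_add, map_smul, S.coframe_apply, Finset.sum_add_distrib, smul_eq_mul]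
  simp [mul_comm]

omit [T2Space M] in
theorem coframe_conn_antisymm {D : Connection d M} (hc : S.IsCompatible D) (A B : Fin (p + 1))
    (X : VField d M) : sgn d M A * S.coframe t A (D X (t B))
      = -(sgn d M B * S.coframe t B (D X (t A))) := by
  have h := hc.1 X (t A) (t B)
  rw [t.orthonormal, lieDeriv_eta, S.τ_symm (D X (t A)), S.τ_frame, S.τ_frame] at h
  simp only [eta_apply, ite_mul, zero_mul, Finset.sum_ite_eq, Finset.mem_univ, if_true] at h
  linear_combination -h

theorem extDeriv_coframe_of_conn {D : Connection d M} (hc : S.IsCompatible D)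
    (ht : ∀ X Y, D.torsion X Y = 0) (A C : Fin (p + 1)) (Y : VField d M) :
    extDeriv (S.coframe t A) (t C) Y = S.coframe t A (D Y (t C))
      - ∑ B, S.coframe t A (D (t C) (t B)) * S.coframe t B Y := by
  rw [extDeriv, Connection.bracket_eq ht, map_sub, S.lieDeriv_coframe_frame,
    S.coframe_conn_expand t hc A (t C) Y]
  ring

/-- Koszul's trick. Torsion-freeness writes `dτ^A(τ_C, ·)` through the forms `τ^A(∇τ_B)`;
antisymmetry in the lowered indices then isolates twice the wanted form. -/
theorem coframe_conn_frame {D : Connection d M} (hc : S.IsCompatible D)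
    (ht : ∀ X Y, D.torsion X Y = 0) (A C : Fin (p + 1)) (X : VField d M) :
    S.coframe t A (D X (t C)) = S.connForm t A C X := by
  have h1 : ∀ B, extDeriv (S.coframe t B) (t A) (t C) = S.coframe t B (D (t C) (t A))
      - S.coframe t B (D (t A) (t C)) := fun B => by
    rw [S.extDeriv_coframe_of_conn t hc ht]
    simp [S.coframe_apply]
  -- The terms along the co-frame cancel termwise by antisymmetry; this cancellation is the purpose
  -- of the last sum in `connForm`.
  have h2 : ∑ B, S.coframe t A (D (t C) (t B)) * S.coframe t B X
      - sgn d M A * sgn d M C * ∑ B, S.coframe t C (D (t A) (t B)) * S.coframe t B X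
      + ∑ B, sgn d M A * sgn d M B * (S.coframe t B (D (t C) (t A))
        - S.coframe t B (D (t A) (t C))) * S.coframe t B X = 0 := by
    rw [Finset.mul_sum, ← Finset.sum_sub_distrib, ← Finset.sum_add_distrib]
    refine Finset.sum_eq_zero fun B _ => ?_
    have e1 := S.coframe_conn_antisymm t hc A B (t C)
    have e2 := S.coframe_conn_antisymm t hc C B (t A)
    linear_combination (sgn d M A * S.coframe t B X) * e1
      - (sgn d M A * S.coframe t B X) * e2
      - S.coframe t A (D (t C) (t B)) * S.coframe t B X * sgn_mul_self (d := d) (M := M) A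
  rw [connForm_apply]
  simp only [h1]
  rw [S.extDeriv_coframe_of_conn t hc ht, S.extDeriv_coframe_of_conn t hc ht]
  have e3 := S.coframe_conn_antisymm t hc A C X
  linear_combination Fn.half * h2 - S.coframe t A (D X (t C)) * Fn.two_mul_half (d := d) (M := M)
    + Fn.half * sgn d M A * e3
    - Fn.half * S.coframe t A (D X (t C)) * sgn_mul_self (d := d) (M := M) A

/-- The longitudinal components of a compatible torsion-free connection. -/
theorem coframe_conn {D : Connection d M} (hc : S.IsCompatible D)
    (ht : ∀ X Y, D.torsion X Y = 0) (A : Fin (p + 1)) (X Y : VField d M) :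
    S.coframe t A (D X Y) = lieDeriv X (S.coframe t A Y)
      + ∑ B, S.connForm t A B X * S.coframe t B Y := by
  rw [S.coframe_conn_expand t hc]
  simp only [S.coframe_conn_frame t hc ht]

/-- Dualises `∇h = 0`: since `α(V) = h(sharp α, V)` on transverse `V`, the condition on 1-forms
becomes metricity of `hForm` on transverse fields. Preservation of the kernel is needed to apply
this to `∇_X (sharp α)`. -/
theorem h_covDeriv_eq {D : Connection d M} (hker : ∀ X, ∀ V ∈ S.Ker, D X V ∈ S.Ker)
    (X : VField d M) (α β : OneForm d M) :
    lieDeriv X (S.h α β) - S.h (D.covDerivOneForm X α) β - S.h α (D.covDerivOneForm X β)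
      = S.hForm t (D X (S.sharp α)) (S.sharp β) + S.hForm t (S.sharp α) (D X (S.sharp β))
        - lieDeriv X (S.hForm t (S.sharp α) (S.sharp β)) := by
  rw [S.h_symm α (D.covDerivOneForm X β), ← S.apply_sharp, ← S.apply_sharp, ← S.apply_sharp]
  change lieDeriv X (α (S.sharp β)) - (lieDeriv X (α (S.sharp β)) - α (D X (S.sharp β)))
    - (lieDeriv X (β (S.sharp α)) - β (D X (S.sharp α))) = _
  rw [S.hForm_symm t (D X (S.sharp α)), S.hForm_sharp t _ (hker X _ (S.sharp_mem_ker _)),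
    S.hForm_sharp t _ (hker X _ (S.sharp_mem_ker _)), S.hForm_sharp t _ (S.sharp_mem_ker _),
    S.apply_sharp β, S.h_symm β, ← S.apply_sharp]
  ring

theorem IsCompatible.lieDeriv_hForm {S : PNCStructure d p M} (t : S.LongitudinalFrame)
    {D : Connection d M} (hc : S.IsCompatible D) (X : VField d M) {V W : VField d M}
    (hV : V ∈ S.Ker) (hW : W ∈ S.Ker) :
    lieDeriv X (S.hForm t V W) = S.hForm t (D X V) W + S.hForm t V (D X W) := by
  obtain ⟨α, rfl⟩ := S.exists_sharp_eq t hV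
  obtain ⟨β, rfl⟩ := S.exists_sharp_eq t hW
  have h := S.h_covDeriv_eq t (fun X V hV => hc.mem_ker X hV) X α β
  rw [hc.2] at h
  linear_combination h

/-- A connection with the right longitudinal components which is metric on transverse vector
fields is compatible. -/
theorem isCompatible_of {D : Connection d M}
    (h1 : ∀ A X Y, S.coframe t A (D X Y) = lieDeriv X (S.coframe t A Y)
      + ∑ B, S.connForm t A B X * S.coframe t B Y)
    (h2 : ∀ X, ∀ V ∈ S.Ker, ∀ W ∈ S.Ker,
      lieDeriv X (S.hForm t V W) = S.hForm t (D X V) W + S.hForm t V (D X W)) :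
    S.IsCompatible D := by
  have hτ : ∀ X Y Z, lieDeriv X (S.τ Y Z) - S.τ (D X Y) Z - S.τ Y (D X Z) = 0 := by
    intro X Y Z
    have h3 : ∑ A, ∑ B, sgn d M A * (S.connForm t A B X * S.coframe t B Y * S.coframe t A Z)
        + ∑ A, ∑ B, sgn d M A * (S.coframe t A Y * (S.connForm t A B X * S.coframe t B Z))
          = 0 := by
      rw [Finset.sum_comm, ← Finset.sum_add_distrib]
      refine Finset.sum_eq_zero fun A _ => ?_
      rw [← Finset.sum_add_distrib]
      refine Finset.sum_eq_zero fun B _ => ?_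
      linear_combination S.coframe t A Y * S.coframe t B Z * S.connForm_antisymm t A B X
    simp only [S.τ_eq t, h1, lieDeriv_sum, lieDeriv_mul, lieDeriv_sgn, mul_zero, add_zero]
    rw [← neg_eq_zero, ← h3]
    simp only [← Finset.sum_sub_distrib, ← Finset.sum_add_distrib, ← Finset.sum_neg_distrib]
    refine Finset.sum_congr rfl fun A _ => ?_
    rw [Finset.sum_add_distrib, ← Finset.mul_sum, ← Finset.mul_sum, ← Finset.mul_sum,
      ← Finset.sum_mul]
    ring
  refine ⟨hτ, fun X α β => ?_⟩
  have hker : ∀ X, ∀ V ∈ S.Ker, D X V ∈ S.Ker := by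
    intro X V hV
    refine LinearMap.ext fun Z => ?_
    have h := hτ X V Z
    rw [S.τ_left_of_mem hV, S.τ_left_of_mem hV, lieDeriv_zero] at h
    rw [LinearMap.zero_apply]
    linear_combination -h
  rw [S.h_covDeriv_eq t hker, h2 X _ (S.sharp_mem_ker α) _ (S.sharp_mem_ker β), sub_self]

/-! ### Consequences of the Augustinian condition -/

omit [T2Space M] in
theorem IsAugustinian.extDeriv_ker {S : PNCStructure d p M} (hS : S.IsAugustinian)
    (t : S.LongitudinalFrame) (A : Fin (p + 1)) {V W : VField d M} (hV : V ∈ S.Ker)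
    (hW : W ∈ S.Ker) : extDeriv (S.coframe t A) V W = 0 := by
  refine Fn.ext fun q => (hS Set.univ isOpen_univ t.vec (fun q _ A B => ?_) V hV W hW q
    (Set.mem_univ q)).1 A
  rw [t.orthonormal, eta_apply, eta, Matrix.diagonal_apply, sgn]
  split_ifs <;> rfl

omit [T2Space M] in
theorem IsAugustinian.extDeriv_frame {S : PNCStructure d p M} (hS : S.IsAugustinian)
    (t : S.LongitudinalFrame) (B C : Fin (p + 1)) {V : VField d M} (hV : V ∈ S.Ker) :
    sgn d M B * extDeriv (S.coframe t B) (t C) V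
      = -(sgn d M C * extDeriv (S.coframe t C) (t B) V) := by
  rw [eq_neg_iff_add_eq_zero]
  refine Fn.ext fun q => ?_
  have h := (hS Set.univ isOpen_univ t.vec (fun q _ A B => ?_) V hV V hV q (Set.mem_univ q)).2 B C
  · simp only [eta, Matrix.diagonal_apply, ite_mul, zero_mul, Finset.sum_add_distrib,
      Finset.sum_ite_eq', Finset.mem_univ, if_true] at h
    rw [Fn.add_apply, Fn.mul_apply, Fn.mul_apply, Fn.zero_apply, ← h, sgn, sgn]
    split_ifs <;> simp
  · rw [t.orthonormal, eta_apply, eta, Matrix.diagonal_apply, sgn]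
    split_ifs <;> rfl

/-- The first structure equation `dτ^A = -ω^A_B ∧ τ^B`. -/
theorem IsAugustinian.extDeriv_coframe {S : PNCStructure d p M} (hS : S.IsAugustinian)
    (t : S.LongitudinalFrame) (A : Fin (p + 1)) (X Y : VField d M) :
    extDeriv (S.coframe t A) X Y
      = ∑ B, (S.coframe t B X * S.connForm t A B Y - S.connForm t A B X * S.coframe t B Y) := by
  have key : extDerivForm (S.coframe t A)
      = ∑ B, wedgeForm (S.coframe t B) (S.connForm t A B) := by
    -- On mixed arguments `connForm` is the antisymmetrised `dτ`; the second Augustinian condition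
    -- says that nothing is lost in antisymmetrising. The first one settles two transverse
    -- arguments, and two frame arguments need no hypothesis.
    have hmix : ∀ C, ∀ V ∈ S.Ker, extDeriv (S.coframe t A) (t C) V = S.connForm t A C V := by
      intro C V hV
      rw [connForm_apply]
      simp only [S.coframe_of_mem t _ hV, mul_zero, Finset.sum_const_zero]
      linear_combination (Fn.half * sgn d M A) * hS.extDeriv_frame t A C hV
        - extDeriv (S.coframe t A) (t C) V * Fn.two_mul_half (d := d) (M := M)
        - Fn.half * extDeriv (S.coframe t A) (t C) V * sgn_mul_self (d := d) (M := M) A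
    refine S.linearMap_ext_frame t (fun C => ?_) fun V hV => ?_ <;>
      refine S.linearMap_ext_frame t (fun E => ?_) fun W hW => ?_
    · simp only [LinearMap.sum_apply, wedgeForm_apply, wedge, extDerivForm_apply, S.coframe_apply,
        connForm_apply, mul_ite, ite_mul, one_mul, mul_one, zero_mul, mul_zero,
        Finset.sum_sub_distrib, Finset.sum_ite_eq', Finset.mem_univ, if_true]
      rw [extDeriv_swap (S.coframe t A) (t E) (t C)]
      linear_combination -extDeriv (S.coframe t A) (t C) (t E)
        * Fn.two_mul_half (d := d) (M := M)
    · simp [LinearMap.sum_apply, wedgeForm_apply, wedge, extDerivForm_apply, S.coframe_apply,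
        S.coframe_of_mem t _ hW, hmix C W hW]
    · simp [LinearMap.sum_apply, wedgeForm_apply, wedge, extDerivForm_apply, S.coframe_apply,
        S.coframe_of_mem t _ hV, extDeriv_swap _ V, hmix E V hV]
    · simp [LinearMap.sum_apply, wedgeForm_apply, wedge, extDerivForm_apply,
        S.coframe_of_mem t _ hV, S.coframe_of_mem t _ hW, hS.extDeriv_ker t A hV hW]
  rw [← extDerivForm_apply, key, LinearMap.sum_apply, LinearMap.sum_apply]
  refine Finset.sum_congr rfl fun B _ => ?_
  rw [wedgeForm_apply, wedge]
  ring

end PNCStructure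

namespace PNCStructure

variable {d p : ℕ} {M : Type*} [TopologicalSpace M]
  [ChartedSpace (EuclideanSpace ℝ (Fin d)) M] [IsManifold (𝓡 d) ∞ M] [T2Space M]
  (S : PNCStructure d p M) (t : S.LongitudinalFrame)

/-! ### The special connection -/

/-- The Koszul form of the degenerate metric `h_{ab}` of a longitudinal frame. -/
def koszul (X Y : VField d M) : OneForm d M where
  toFun Z := Fn.half * (lieDeriv X (S.hForm t Y Z) + lieDeriv Y (S.hForm t X Z)
    - lieDeriv Z (S.hForm t X Y) + S.hForm t (bracket X Y) Z - S.hForm t (bracket X Z) Y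
    - S.hForm t (bracket Y Z) X)
  map_add' Z Z' := by
    simp only [map_add, LinearMap.add_apply, lieDeriv_add, lieDeriv_add_left, bracket_add_right]
    ring
  map_smul' f Z := by
    simp only [map_add, map_smul, LinearMap.add_apply, LinearMap.smul_apply, smul_eq_mul,
      lieDeriv_mul, lieDeriv_smul_left, bracket_smul_right, RingHom.id_apply]
    rw [S.hForm_symm t Z X, S.hForm_symm t Z Y]
    ring

theorem koszul_apply (X Y Z : VField d M) : S.koszul t X Y Z =
    Fn.half * (lieDeriv X (S.hForm t Y Z) + lieDeriv Y (S.hForm t X Z)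
    - lieDeriv Z (S.hForm t X Y) + S.hForm t (bracket X Y) Z - S.hForm t (bracket X Z) Y
    - S.hForm t (bracket Y Z) X) := rfl

theorem koszul_add_left (X X' Y : VField d M) :
    S.koszul t (X + X') Y = S.koszul t X Y + S.koszul t X' Y := by
  refine LinearMap.ext fun Z => ?_
  simp only [koszul_apply, map_add, LinearMap.add_apply, lieDeriv_add, lieDeriv_add_left,
    bracket_add_left]
  ring

theorem koszul_smul_left (f : Fn d M) (X Y : VField d M) :
    S.koszul t (f • X) Y = f • S.koszul t X Y := by
  refine LinearMap.ext fun Z => ?_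
  simp only [koszul_apply, map_add, map_smul, map_neg, LinearMap.add_apply, LinearMap.smul_apply,
    LinearMap.neg_apply, smul_eq_mul, lieDeriv_mul, lieDeriv_smul_left, bracket_smul_left]
  ring

theorem koszul_add_right (X Y Y' : VField d M) :
    S.koszul t X (Y + Y') = S.koszul t X Y + S.koszul t X Y' := by
  refine LinearMap.ext fun Z => ?_
  simp only [koszul_apply, map_add, LinearMap.add_apply, lieDeriv_add, lieDeriv_add_left,
    bracket_add_left, bracket_add_right]
  ring

theorem koszul_smul_right (X : VField d M) (f : Fn d M) (Y : VField d M) :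
    S.koszul t X (f • Y) = lieDeriv X f • S.hForm t Y + f • S.koszul t X Y := by
  refine LinearMap.ext fun Z => ?_
  simp only [koszul_apply, map_add, map_smul, map_neg, LinearMap.add_apply, LinearMap.smul_apply,
    LinearMap.neg_apply, smul_eq_mul, lieDeriv_mul, lieDeriv_smul_left, bracket_smul_left,
    bracket_smul_right]
  rw [S.hForm_symm t Y X]
  linear_combination lieDeriv X f * S.hForm t Y Z * Fn.two_mul_half (d := d) (M := M)

/-- The covariant derivative of the special connection of a longitudinal frame. -/
def specialFun (X Y : VField d M) : VField d M :=
  ∑ A, (lieDeriv X (S.coframe t A Y)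
    + ∑ B, S.connForm t A B X * S.coframe t B Y) • t A + S.sharp (S.koszul t X Y)

theorem coframe_specialFun (A : Fin (p + 1)) (X Y : VField d M) :
    S.coframe t A (S.specialFun t X Y) = lieDeriv X (S.coframe t A Y)
      + ∑ B, S.connForm t A B X * S.coframe t B Y := by
  rw [specialFun, map_add, S.coframe_of_mem t A (S.sharp_mem_ker _), map_sum]
  simp [S.coframe_apply]

theorem hForm_specialFun (X Y : VField d M) {V : VField d M} (hV : V ∈ S.Ker) :
    S.hForm t (S.specialFun t X Y) V = S.koszul t X Y V := by
  rw [specialFun, map_add, LinearMap.add_apply, S.hForm_sharp t _ hV]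
  simp [LinearMap.sum_apply]

/-- The special connection of a longitudinal frame. -/
def special : Connection d M where
  toFun := S.specialFun t
  add_left X X' Y := by
    refine S.ext_frame t (fun A => ?_) fun V hV => ?_
    · simp only [map_add, coframe_specialFun, lieDeriv_add_left, add_mul, Finset.sum_add_distrib]
      ring
    · simp only [map_add, LinearMap.add_apply, S.hForm_specialFun t _ _ hV, koszul_add_left]
  smul_left f X Y := by
    refine S.ext_frame t (fun A => ?_) fun V hV => ?_
    · simp only [map_smul, coframe_specialFun, lieDeriv_smul_left, smul_eq_mul, mul_add,
        Finset.mul_sum, mul_assoc]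
    · simp only [map_smul, LinearMap.smul_apply, S.hForm_specialFun t _ _ hV, koszul_smul_left]
  add_right X Y Y' := by
    refine S.ext_frame t (fun A => ?_) fun V hV => ?_
    · simp only [map_add, coframe_specialFun, lieDeriv_add, mul_add, Finset.sum_add_distrib]
      ring
    · simp only [map_add, LinearMap.add_apply, S.hForm_specialFun t _ _ hV, koszul_add_right]
  leibniz X f Y := by
    refine S.ext_frame t (fun A => ?_) fun V hV => ?_
    · simp only [map_smul, map_add, coframe_specialFun, lieDeriv_mul, smul_eq_mul, mul_add,
        Finset.mul_sum, mul_left_comm _ f]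
      ring
    · simp only [map_add, map_smul, LinearMap.smul_apply, LinearMap.add_apply,
        S.hForm_specialFun t _ _ hV, koszul_smul_right]

/-- The longitudinal components are right by construction. In the sum of the two Koszul forms for
`V, W` and `W, V` everything cancels except twice half of `X(h(V, W))`. -/
theorem special_isCompatible : S.IsCompatible (S.special t) := by
  refine S.isCompatible_of t (fun A X Y => S.coframe_specialFun t A X Y) fun X V hV W hW => ?_
  rw [S.hForm_symm t V (S.special t X W)]
  change _ = S.hForm t (S.specialFun t X V) W + S.hForm t (S.specialFun t X W) V
  rw [S.hForm_specialFun t X V hW, S.hForm_specialFun t X W hV, koszul_apply, koszul_apply,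
    S.hForm_symm t W V, bracket_swap W V, map_neg, LinearMap.neg_apply]
  linear_combination -lieDeriv X (S.hForm t V W) * Fn.two_mul_half (d := d) (M := M)

/-- The longitudinal part of the torsion vanishes precisely by the structure equation, hence the
hypothesis `hS`; the transverse part vanishes by the usual antisymmetry of the Koszul form. -/
theorem special_torsion (hS : S.IsAugustinian) (X Y : VField d M) :
    (S.special t).torsion X Y = 0 := by
  change S.specialFun t X Y - S.specialFun t Y X - bracket X Y = 0
  refine S.ext_frame t (fun A => ?_) fun V hV => ?_
  · have h := hS.extDeriv_coframe t A X Y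
    rw [Finset.sum_sub_distrib, extDeriv] at h
    simp only [map_sub, coframe_specialFun, map_zero, mul_comm (S.connForm t A _ Y)]
    linear_combination h
  · rw [map_sub, map_sub, map_zero, LinearMap.sub_apply, LinearMap.sub_apply,
      S.hForm_specialFun t _ _ hV, S.hForm_specialFun t _ _ hV, koszul_apply, koszul_apply,
      S.hForm_symm t Y X, bracket_swap Y X, map_neg, LinearMap.neg_apply, LinearMap.zero_apply]
    linear_combination S.hForm t (bracket X Y) V * Fn.two_mul_half (d := d) (M := M)

/-- As `h` annihilates the frame, the Koszul form reduces to `½ h([τ_B, τ_A], V)` on `(τ_B, τ_A)`,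
antisymmetric in `A, B`, and to half the Lie derivative of `h` along `τ_A` on `(V, τ_A)`, symmetric
in `V, W`. These are the two gauge conditions. -/
theorem special_isSpecial (hS : S.IsAugustinian) : S.IsSpecial t (S.special t) := by
  refine ⟨S.special_isCompatible t, S.special_torsion t hS, fun A B V hV => ?_,
    fun A V hV W hW => ?_⟩
  · change S.hForm t (S.specialFun t (t B) (t A)) V - S.hForm t (S.specialFun t V (t A)) (t B)
      = -(S.hForm t (S.specialFun t (t A) (t B)) V - S.hForm t (S.specialFun t V (t B)) (t A))
    rw [S.hForm_specialFun t _ _ hV, S.hForm_specialFun t _ _ hV, koszul_apply, koszul_apply,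
      bracket_swap (t B) (t A)]
    simp only [hForm_frame_left, hForm_frame_right, lieDeriv_zero, map_neg, LinearMap.neg_apply]
    ring
  · change S.hForm t (S.specialFun t V (t A)) W - S.hForm t (S.specialFun t W (t A)) V = 0
    rw [S.hForm_specialFun t _ _ hW, S.hForm_specialFun t _ _ hV, koszul_apply, koszul_apply,
      bracket_swap V (t A), bracket_swap W (t A), S.hForm_symm t W V]
    simp only [hForm_frame_left, hForm_frame_right, lieDeriv_zero, map_neg, LinearMap.neg_apply]
    ring

/-! ### Connections with a given field strength -/

/-- The tensor `Γ^c_{ab} - Γ₀^c_{ab} = τ^A_{(a} F_{|A|b)e} h^{ce}`. -/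
def shift (F : Fin (p + 1) → TwoForm d M) (X Y : VField d M) : VField d M :=
  (Fn.half : Fn d M) • ∑ A, (S.coframe t A X • S.sharp (contract (F A) Y)
    + S.coframe t A Y • S.sharp (contract (F A) X))

theorem shift_symm (F : Fin (p + 1) → TwoForm d M) (X Y : VField d M) :
    S.shift t F X Y = S.shift t F Y X := by
  simp only [shift, add_comm]

theorem shift_add_left (F : Fin (p + 1) → TwoForm d M) (X X' Y : VField d M) :
    S.shift t F (X + X') Y = S.shift t F X Y + S.shift t F X' Y := by
  rw [shift, shift, shift, ← smul_add, ← Finset.sum_add_distrib]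
  congr 1
  refine Finset.sum_congr rfl fun A _ => ?_
  have h : contract (F A) (X + X') = contract (F A) X + contract (F A) X' :=
    (contractHom (F A)).map_add X X'
  rw [h, map_add, map_add, add_smul, smul_add]
  abel

theorem shift_smul_left (F : Fin (p + 1) → TwoForm d M) (f : Fn d M) (X Y : VField d M) :
    S.shift t F (f • X) Y = f • S.shift t F X Y := by
  rw [shift, shift, smul_smul, mul_comm f, mul_smul, Finset.smul_sum (r := f)]
  refine congrArg _ (Finset.sum_congr rfl fun A _ => ?_)
  have h : contract (F A) (f • X) = f • contract (F A) X := (contractHom (F A)).map_smul f X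
  rw [h, map_smul, map_smul, smul_eq_mul, smul_add, smul_smul, smul_smul, smul_smul,
    mul_comm f (S.coframe t A Y)]

theorem shift_mem_ker (F : Fin (p + 1) → TwoForm d M) (X Y : VField d M) :
    S.shift t F X Y ∈ S.Ker := by
  have h : ∀ A, S.coframe t A X • S.sharp (contract (F A) Y)
      + S.coframe t A Y • S.sharp (contract (F A) X) ∈ S.Ker := fun A =>
    S.Ker.add_mem (S.Ker.smul_mem _ (S.sharp_mem_ker _)) (S.Ker.smul_mem _ (S.sharp_mem_ker _))
  exact S.Ker.smul_mem _ (S.Ker.sum_mem fun A _ => h A)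

theorem hForm_shift (F : Fin (p + 1) → TwoForm d M) (X Y : VField d M) {V : VField d M}
    (hV : V ∈ S.Ker) : S.hForm t (S.shift t F X Y) V = Fn.half *
      ∑ A, (S.coframe t A X * F A ![Y, V] + S.coframe t A Y * F A ![X, V]) := by
  simp [shift, LinearMap.sum_apply, S.hForm_sharp t _ hV, contract_apply]

/-- The connection with `Γ^c_{ab} = Γ₀^c_{ab} + τ^A_{(a} F_{|A|b)e} h^{ce}`. -/
def shifted (D : Connection d M) (F : Fin (p + 1) → TwoForm d M) : Connection d M where
  toFun X Y := D X Y + S.shift t F X Y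
  add_left X X' Y := by
    rw [D.add_left, shift_add_left]
    abel
  smul_left f X Y := by rw [D.smul_left, shift_smul_left, smul_add]
  add_right X Y Y' := by
    rw [D.add_right, S.shift_symm, shift_add_left, S.shift_symm t F Y, S.shift_symm t F Y']
    abel
  leibniz X f Y := by
    rw [D.leibniz, S.shift_symm, shift_smul_left, S.shift_symm t F Y, smul_add, add_assoc]

theorem shifted_apply (D : Connection d M) (F : Fin (p + 1) → TwoForm d M) (X Y : VField d M) :
    S.shifted t D F X Y = D X Y + S.shift t F X Y := rfl

theorem apply_shifted (D : Connection d M) (F : Fin (p + 1) → TwoForm d M) (X Y : VField d M)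
    (β : OneForm d M) : β (S.shifted t D F X Y) = β (D X Y)
      + (1 / 2 : ℝ) • ∑ A, (S.coframe t A X * S.h β (contract (F A) Y)
        + S.coframe t A Y * S.h β (contract (F A) X)) := by
  rw [shifted_apply, map_add, Fn.half_smul, shift]
  simp [S.apply_sharp]

/-- The added tensor is transverse, so it leaves longitudinal components alone; on transverse fields
only `τ^A(X) F_A(V, W)` survives, and its antisymmetry keeps the metric parallel. -/
theorem shifted_isCompatible {D : Connection d M} (hc : S.IsCompatible D)
    (ht : ∀ X Y, D.torsion X Y = 0) (F : Fin (p + 1) → TwoForm d M) :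
    S.IsCompatible (S.shifted t D F) := by
  refine S.isCompatible_of t (fun A X Y => ?_) fun X V hV W hW => ?_
  · rw [shifted_apply, map_add, S.coframe_of_mem t A (S.shift_mem_ker t F X Y), add_zero,
      S.coframe_conn t hc ht]
  · rw [shifted_apply, shifted_apply, map_add, map_add, LinearMap.add_apply,
      hc.lieDeriv_hForm t X hV hW,
      S.hForm_symm t V (S.shift t F X W), S.hForm_shift t F X V hW, S.hForm_shift t F X W hV]
    have h : ∑ A, (S.coframe t A X * F A ![V, W] + S.coframe t A V * F A ![X, W])
        + ∑ A, (S.coframe t A X * F A ![W, V] + S.coframe t A W * F A ![X, V]) = 0 := by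
      rw [← Finset.sum_add_distrib]
      refine Finset.sum_eq_zero fun A _ => ?_
      rw [S.coframe_of_mem t A hV, S.coframe_of_mem t A hW, (F A).swap V W]
      ring
    linear_combination -Fn.half * h

theorem shifted_torsion {D : Connection d M} (ht : ∀ X Y, D.torsion X Y = 0)
    (F : Fin (p + 1) → TwoForm d M) (X Y : VField d M) : (S.shifted t D F).torsion X Y = 0 := by
  rw [← ht X Y, Connection.torsion, Connection.torsion, shifted_apply, shifted_apply,
    S.shift_symm t F Y X]
  abel

theorem inducedFieldStrength_eq (D : Connection d M) (A : Fin (p + 1)) (X Y : VField d M) :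
    S.inducedFieldStrength t D A X Y
      = S.hForm t (D X (t A)) Y - S.hForm t (D Y (t A)) X := rfl

/-- On `(τ_B, V)` the induced field strength grows by `½ (F_A(τ_B, V) + F_B(τ_A, V))`, which differs
from `F_A(τ_B, V)` by a term antisymmetric in `A, B`; on `(V, W)` it grows by exactly `F_A(V, W)`.
-/
theorem shifted_gauge (D : Connection d M) (F : Fin (p + 1) → TwoForm d M) :
    S.IsGauge t fun A X Y => F A ![X, Y] - (S.inducedFieldStrength t (S.shifted t D F) A X Y
      - S.inducedFieldStrength t D A X Y) := by
  have hs : ∀ A X Y, S.inducedFieldStrength t (S.shifted t D F) A X Y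
      - S.inducedFieldStrength t D A X Y = S.hForm t (S.shift t F X (t A)) Y
        - S.hForm t (S.shift t F Y (t A)) X := by
    intro A X Y
    simp only [inducedFieldStrength_eq, shifted_apply, map_add, LinearMap.add_apply]
    ring
  refine ⟨fun A B V hV => ?_, fun A V hV W hW => ?_⟩
  · simp only [hs, hForm_frame_right, S.hForm_shift t F _ _ hV, S.coframe_apply, ite_mul, one_mul,
      zero_mul, Finset.sum_add_distrib, Finset.sum_ite_eq', Finset.mem_univ, if_true]
    linear_combination (-(F A ![t B, V] + F B ![t A, V])) * Fn.two_mul_half (d := d) (M := M)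
  · simp only [hs, S.hForm_shift t F _ _ hV, S.hForm_shift t F _ _ hW, S.coframe_apply,
      S.coframe_of_mem t _ hV, S.coframe_of_mem t _ hW, ite_mul, one_mul,
      zero_mul, zero_add, Finset.sum_ite_eq', Finset.mem_univ, if_true]
    rw [(F A).swap W V]
    linear_combination (-F A ![V, W]) * Fn.two_mul_half (d := d) (M := M)

/-- The difference tensor `T` is symmetric and transverse, and `h(T(X, V), W)` is antisymmetric in
transverse `V, W`. Each block is then both symmetric and antisymmetric: two transverse arguments by
the cyclic Koszul argument, `(V, τ_A)` by the second gauge condition against metricity, `(τ_A, τ_B)`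
by the first gauge condition against symmetry. -/
theorem eq_of_gauge {D D' : Connection d M} (hc : S.IsCompatible D) (hc' : S.IsCompatible D')
    (ht : ∀ X Y, D.torsion X Y = 0) (ht' : ∀ X Y, D'.torsion X Y = 0)
    (hg : S.IsGauge t fun A X Y => S.inducedFieldStrength t D A X Y
      - S.inducedFieldStrength t D' A X Y) : D = D' := by
  let T : VField d M → VField d M → VField d M := fun X Y => D X Y - D' X Y
  have hT : ∀ X Y, T X Y = D X Y - D' X Y := fun _ _ => rfl
  have hsymm : ∀ X Y, T X Y = T Y X := by
    intro X Y
    have e1 := Connection.bracket_eq ht X Y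
    rw [Connection.bracket_eq ht' X Y, sub_eq_sub_iff_add_eq_add] at e1
    rw [hT, hT, sub_eq_sub_iff_add_eq_add]
    exact e1.symm.trans (add_comm _ _)
  have hker : ∀ X Y, T X Y ∈ S.Ker := by
    intro X Y
    have h : S.proj t (T X Y) = T X Y := by
      simp [proj, hT, S.coframe_conn t hc ht, S.coframe_conn t hc' ht']
    rw [← h]
    exact S.proj_mem_ker t _
  have hanti : ∀ X, ∀ V ∈ S.Ker, ∀ W ∈ S.Ker,
      S.hForm t (T X V) W = -S.hForm t (T X W) V := by
    intro X V hV W hW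
    have e1 := hc.lieDeriv_hForm t X hV hW
    rw [hc'.lieDeriv_hForm t X hV hW, S.hForm_symm t V, S.hForm_symm t V] at e1
    simp only [hT, map_sub, LinearMap.sub_apply]
    linear_combination -e1
  have hlin : ∀ Y, ∃ L : VField d M →ₗ[Fn d M] VField d M, ∀ X, L X = T X Y :=
    fun Y => ⟨D.leftHom Y - D'.leftHom Y, fun X => rfl⟩
  have h1 : ∀ U ∈ S.Ker, ∀ V ∈ S.Ker, T U V = 0 := by
    intro U hU V hV
    refine S.eq_zero_of_hForm t (hker U V) fun W hW => Fn.eq_zero_of_add_self ?_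
    have e1 := hanti U V hV W hW
    have e2 := hanti W U hU V hV
    have e3 := hanti V W hW U hU
    rw [hsymm U W] at e1
    rw [hsymm W V] at e2
    rw [hsymm V U] at e3
    linear_combination e1 - e2 + e3
  have h2 : ∀ A, ∀ V ∈ S.Ker, T V (t A) = 0 := by
    intro A V hV
    refine S.eq_zero_of_hForm t (hker _ _) fun W hW => Fn.eq_zero_of_add_self ?_
    have e1 := hg.2 A V hV W hW
    have e2 := hanti (t A) V hV W hW
    rw [hsymm (t A) V, hsymm (t A) W] at e2
    simp only [inducedFieldStrength_eq] at e1
    simp only [hT, map_sub, LinearMap.sub_apply] at e2 ⊢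
    linear_combination e1 + e2
  have h3 : ∀ A B, T (t A) (t B) = 0 := by
    intro A B
    refine S.eq_zero_of_hForm t (hker _ _) fun W hW => Fn.eq_zero_of_add_self ?_
    have e1 := hg.1 A B W hW
    have e2 : S.hForm t (T (t B) (t A)) W = S.hForm t (T (t A) (t B)) W := by rw [hsymm]
    simp only [inducedFieldStrength_eq, hForm_frame_right] at e1
    simp only [hT, map_sub, LinearMap.sub_apply] at e2 ⊢
    linear_combination e1 - e2
  have h4 : ∀ X Y, T X Y = 0 := by
    intro X Y
    have key : ∀ Y, (∀ A, T (t A) Y = 0) → (∀ V ∈ S.Ker, T V Y = 0) → ∀ X, T X Y = 0 := by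
      intro Y hA hV X
      obtain ⟨L, hL⟩ := hlin Y
      have : L = 0 := S.linearMap_ext_frame t (fun A => by rw [hL, hA]; rfl)
        fun V hV' => by rw [hL, hV V hV']; rfl
      rw [← hL, this]
      rfl
    refine key Y (fun A => ?_) (fun V hV => ?_) X
    · rw [hsymm]
      exact key (t A) (fun B => h3 B A) (fun V hV => h2 A V hV) Y
    · rw [hsymm]
      exact key V (fun B => by rw [hsymm]; exact h2 B V hV) (fun U hU => h1 U hU V hV) Y
  refine Connection.ext (funext fun X => funext fun Y => sub_eq_zero.mp (h4 X Y))

/-! ### The connection of a pair -/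

/-- The induced field strength as a tuple of 2-forms. -/
def inducedForm (D : Connection d M) (A : Fin (p + 1)) : TwoForm d M :=
  TwoForm.mk ((S.hForm t).comp (D.leftHom (t A)) - ((S.hForm t).comp (D.leftHom (t A))).flip)
    fun X => by simp

theorem inducedForm_apply (D : Connection d M) (A : Fin (p + 1)) (X Y : VField d M) :
    S.inducedForm t D A ![X, Y] = S.inducedFieldStrength t D A X Y := rfl

omit [T2Space M] in
theorem cls_eq_iff (F G : Fin (p + 1) → TwoForm d M) :
    S.cls t F = S.cls t G ↔ S.IsGauge t fun A X Y => F A ![X, Y] - G A ![X, Y] := by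
  rw [cls, cls, Submodule.mkQ_apply, Submodule.mkQ_apply, Submodule.Quotient.eq]
  rfl

/-- A pair maps to a connection if and only if the latter is compatible and torsion-free and
induces the field strength of the pair. -/
theorem mapsTo_iff (hS : S.IsAugustinian) (c : S.FieldStrength t) (D : Connection d M) :
    S.MapsTo ⟨t, c⟩ D ↔ (S.IsCompatible D ∧ ∀ X Y, D.torsion X Y = 0) ∧
      S.cls t (S.inducedForm t D) = c := by
  -- The special connection starts from class zero, so shifting it by `F` yields the class of `F`.
  have key : ∀ (D₀ : Connection d M) (F : Fin (p + 1) → TwoForm d M), S.IsSpecial t D₀ →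
      S.cls t (S.inducedForm t (S.shifted t D₀ F)) = S.cls t F := by
    intro D₀ F h0
    have h1 := S.shifted_gauge t D₀ F
    symm
    rw [cls_eq_iff]
    refine ⟨fun A B V hV => ?_, fun A V hV W hW => ?_⟩
    · simp only [inducedForm_apply]
      linear_combination h1.1 A B V hV - h0.2.2.1 A B V hV
    · simp only [inducedForm_apply]
      linear_combination h1.2 A V hV W hW - h0.2.2.2 A V hV W hW
  constructor
  · rintro ⟨D₀, F, h0, hF, hD⟩
    have h1 : D = S.shifted t D₀ F := by
      refine Connection.ext (funext fun X => funext fun Y => S.ext_oneForm fun β => ?_)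
      rw [hD, S.apply_shifted]
    subst h1
    refine ⟨⟨S.shifted_isCompatible t h0.1 h0.2.1 F, S.shifted_torsion t h0.2.1 F⟩, ?_⟩
    rw [key D₀ F h0]
    exact hF.symm
  · rintro ⟨⟨hc, ht⟩, rfl⟩
    have h0 := S.special_isSpecial t hS
    refine ⟨S.special t, S.inducedForm t D, h0, rfl, fun X Y β => ?_⟩
    -- Rebuilding a connection from its own field strength gives one with the same class, hence the
    -- same connection.
    have h1 : D = S.shifted t (S.special t) (S.inducedForm t D) := by
      refine S.eq_of_gauge t hc (S.shifted_isCompatible t h0.1 h0.2.1 _) ht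
        (S.shifted_torsion t h0.2.1 _) ?_
      exact (S.cls_eq_iff t (S.inducedForm t D) _).mp (key _ (S.inducedForm t D) h0).symm
    conv_lhs => rw [h1]
    exact S.apply_shifted t _ _ X Y β

/-- Each pair maps to exactly one connection. -/
theorem existsUnique_mapsTo (hS : S.IsAugustinian) (x : S.Pair) : ∃! D, S.MapsTo x D := by
  obtain ⟨t, c⟩ := x
  obtain ⟨F, rfl⟩ := (S.gauge t).mkQ_surjective c
  have h0 := S.special_isSpecial t hS
  refine ⟨S.shifted t (S.special t) F, ⟨_, F, h0, rfl, S.apply_shifted t _ F⟩, fun D hD => ?_⟩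
  have h1 : S.MapsTo ⟨t, S.cls t F⟩ (S.shifted t (S.special t) F) :=
    ⟨_, F, h0, rfl, S.apply_shifted t _ F⟩
  obtain ⟨⟨hc, ht⟩, h2⟩ := (S.mapsTo_iff t hS _ D).mp hD
  obtain ⟨⟨hc', ht'⟩, h3⟩ := (S.mapsTo_iff t hS _ _).mp h1
  exact S.eq_of_gauge t hc hc' ht ht' ((S.cls_eq_iff t _ _).mp (h2.trans h3.symm))

end PNCStructure

namespace PNCStructure

variable {d p : ℕ} {M : Type*} [TopologicalSpace M]
  [ChartedSpace (EuclideanSpace ℝ (Fin d)) M] [IsManifold (𝓡 d) ∞ M]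

/-! ### Change of frame -/

theorem LongitudinalFrame.act_apply {S : PNCStructure d p M} (t : S.LongitudinalFrame) (g : S.LG)
    (A : Fin (p + 1)) : t.act g A = ∑ B, g.lam B A • t B + g.boost A := rfl

theorem LG.restBoost_mem_ker {S : PNCStructure d p M} (g : S.LG) (B : Fin (p + 1)) :
    g.restBoost B ∈ S.Ker :=
  S.Ker.sum_mem fun C _ => S.Ker.smul_mem _ (g.transverse C)

theorem LG.sum_lam_inv_mul {S : PNCStructure d p M} (g : S.LG) (A C : Fin (p + 1)) :
    ∑ B, g.lam⁻¹ A B * g.lam B C = if A = C then 1 else 0 := by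
  rw [← Matrix.mul_apply, g.inv_mul_lam, Matrix.one_apply]

theorem LG.sum_lam_mul_inv {S : PNCStructure d p M} (g : S.LG) (A C : Fin (p + 1)) :
    ∑ B, g.lam A B * g.lam⁻¹ B C = if A = C then 1 else 0 := by
  rw [← Matrix.mul_apply, g.lam_mul_inv, Matrix.one_apply]

theorem LG.sum_lam_smul_restBoost {S : PNCStructure d p M} (g : S.LG) (A : Fin (p + 1)) :
    ∑ B, g.lam B A • g.restBoost B = g.boost A := by
  simp only [restBoost, Finset.smul_sum, smul_smul]
  rw [Finset.sum_comm]
  have h : ∀ C, ∑ B, (g.lam B A * g.lam⁻¹ C B) • g.boost C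
      = (if C = A then (1 : Fn d M) else 0) • g.boost C := fun C => by
    rw [← Finset.sum_smul, ← g.sum_lam_inv_mul]
    simp only [mul_comm]
  simp [h]

/-- The frame `τ_B + W_B`, which is `τ'_A` up to a local Lorentz transformation. -/
def boosted {S : PNCStructure d p M} (t : S.LongitudinalFrame) (g : S.LG) (B : Fin (p + 1)) :
    VField d M := t B + g.restBoost B

variable (S : PNCStructure d p M) (t : S.LongitudinalFrame) (g : S.LG)

theorem act_eq_sum_boosted (A : Fin (p + 1)) :
    t.act g A = ∑ B, g.lam B A • boosted t g B := by
  simp only [boosted, smul_add, Finset.sum_add_distrib, g.sum_lam_smul_restBoost]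
  rfl

theorem boosted_eq_sum_act (B : Fin (p + 1)) :
    boosted t g B = ∑ A, g.lam⁻¹ A B • t.act g A := by
  simp only [act_eq_sum_boosted, Finset.smul_sum, smul_smul]
  rw [Finset.sum_comm]
  have h : ∀ C, ∑ A, (g.lam⁻¹ A B * g.lam C A) • boosted t g C
      = (if C = B then (1 : Fn d M) else 0) • boosted t g C := fun C => by
    rw [← Finset.sum_smul, ← g.sum_lam_mul_inv]
    simp only [mul_comm]
  simp [h]

theorem coframe_boosted (A B : Fin (p + 1)) :
    S.coframe t A (boosted t g B) = if A = B then 1 else 0 := by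
  rw [boosted, map_add, S.coframe_apply, S.coframe_of_mem t A (g.restBoost_mem_ker B), add_zero]

theorem coframe_act_frame (A B : Fin (p + 1)) : S.coframe t A (t.act g B) = g.lam A B := by
  rw [t.act_apply, map_add, S.coframe_of_mem t A (g.transverse B)]
  simp [S.coframe_apply]

variable [T2Space M]

theorem coframe_act (A : Fin (p + 1)) :
    S.coframe (t.act g) A = ∑ B, g.lam⁻¹ A B • S.coframe t B := by
  refine S.linearMap_ext_frame (t.act g) (fun C => ?_) fun V hV => ?_
  · rw [S.coframe_apply, LinearMap.sum_apply, ← g.sum_lam_inv_mul]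
    simp only [LinearMap.smul_apply, coframe_act_frame, smul_eq_mul]
  · simp [LinearMap.sum_apply, S.coframe_of_mem _ _ hV]

/-- On transverse fields both tensors are `γ`, while the new one annihilates `τ_C + W_C`, so its
value on `(τ_C, V)` must be `-h(W_C, V)`. -/
theorem hForm_act_of_mem (X : VField d M) {V : VField d M} (hV : V ∈ S.Ker) :
    S.hForm (t.act g) X V = S.hForm t X V
      - ∑ C, S.coframe t C X * S.hForm t (g.restBoost C) V := by
  have key : (S.hForm (t.act g)).flip V = (S.hForm t).flip V
      - ∑ C, S.hForm t (g.restBoost C) V • S.coframe t C := by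
    refine S.linearMap_ext_frame (t.act g) (fun A => ?_) fun W hW => ?_
    · simp only [LinearMap.flip_apply, hForm_frame_left, LinearMap.sub_apply, LinearMap.sum_apply,
        LinearMap.smul_apply, coframe_act_frame, smul_eq_mul]
      rw [act_eq_sum_boosted]
      simp [LinearMap.sum_apply, boosted, mul_comm]
    · simp [LinearMap.sum_apply, S.hForm_of_mem _ hW hV, S.coframe_of_mem _ _ hW]
  have h := LinearMap.congr_fun key X
  simpa [LinearMap.sum_apply, mul_comm] using h

theorem hForm_act_boosted_left (B : Fin (p + 1)) (Y : VField d M) :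
    S.hForm (t.act g) (boosted t g B) Y = 0 := by
  rw [boosted_eq_sum_act]
  simp [LinearMap.sum_apply]

/-- Derivatives of `Λ` drop out because they multiply `τ_B + W_B`, which the new `h` annihilates.
The Lorentz part is thus a mere change of index, and only boosts need computation. -/
theorem inducedFieldStrength_act (D : Connection d M) (A : Fin (p + 1)) (X Y : VField d M) :
    S.inducedFieldStrength (t.act g) D A X Y = ∑ B, g.lam B A *
      (S.hForm (t.act g) (D X (boosted t g B)) Y - S.hForm (t.act g) (D Y (boosted t g B)) X) := by
  have h : ∀ X Y, S.hForm (t.act g) (D X (t.act g A)) Y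
      = ∑ B, g.lam B A * S.hForm (t.act g) (D X (boosted t g B)) Y := by
    intro X Y
    rw [act_eq_sum_boosted, D.sum_right]
    simp [D.leibniz, LinearMap.sum_apply, hForm_act_boosted_left]
  rw [inducedFieldStrength_eq, h, h, ← Finset.sum_sub_distrib]
  simp only [mul_sub]

/-! ### The transformed field strength -/

/-- The 1-forms `Δ^D_B` as linear maps. -/
def ΔForm (D B : Fin (p + 1)) : OneForm d M :=
  (Fn.half : Fn d M) • ((sgn d M D * sgn d M B) • extDerivForm (S.coframe t B) (t D)
    - extDerivForm (S.coframe t D) (t B))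

omit [T2Space M] in
theorem ΔForm_apply (D B : Fin (p + 1)) (X : VField d M) : S.ΔForm t D B X = Fn.half *
    (sgn d M D * sgn d M B * extDeriv (S.coframe t B) (t D) X
      - extDeriv (S.coframe t D) (t B) X) := rfl

omit [T2Space M] in
theorem Δ_eq (D B : Fin (p + 1)) : S.Δ t D B = S.ΔForm t D B := by
  funext X
  rw [Δ, Fn.half_smul, ΔForm_apply]
  simp [eta_apply]

omit [T2Space M] in
theorem connForm_eq (A B : Fin (p + 1)) (X : VField d M) : S.connForm t A B X = -S.ΔForm t A B X
    - Fn.half * ∑ D, sgn d M A * sgn d M D * extDeriv (S.coframe t D) (t A) (t B)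
      * S.coframe t D X := by
  rw [connForm_apply, ΔForm_apply]
  ring

/-- The transformation law before the local Lorentz transformation, as a bilinear form. -/
def boostedForm (F : Fin (p + 1) → TwoForm d M) (B : Fin (p + 1)) :
    VField d M →ₗ[Fn d M] VField d M →ₗ[Fn d M] Fn d M :=
  contractHom (F B) + extDerivForm (S.hForm t (g.restBoost B))
    + (Fn.half : Fn d M) • ∑ D, wedgeForm (S.coframe t D)
        (differentialForm (S.hForm t (g.restBoost D) (g.restBoost B)))
    + ∑ D, wedgeForm (S.ΔForm t D B) (S.hForm t (g.restBoost D))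
    + ∑ C, ∑ D, (Fn.half * (sgn d M D * sgn d M C * extDeriv (S.coframe t C) (t B) (t D)))
        • wedgeForm (S.hForm t (g.restBoost D)) (S.coframe t C)
    - ∑ C, ∑ D, S.hForm t (g.restBoost C) (g.restBoost D)
        • wedgeForm (S.ΔForm t D B) (S.coframe t C)

theorem boostedForm_apply (F : Fin (p + 1) → TwoForm d M) (B : Fin (p + 1)) (X Y : VField d M) :
    S.boostedForm t g F B X Y = F B ![X, Y] + extDeriv (S.hForm t (g.restBoost B)) X Y
    + Fn.half * ∑ D, wedge (S.coframe t D)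
        (differentialForm (S.hForm t (g.restBoost D) (g.restBoost B))) X Y
    + ∑ D, wedge (S.ΔForm t D B) (S.hForm t (g.restBoost D)) X Y
    + ∑ C, ∑ D, Fn.half * (sgn d M D * sgn d M C * extDeriv (S.coframe t C) (t B) (t D))
        * wedge (S.hForm t (g.restBoost D)) (S.coframe t C) X Y
    - ∑ C, ∑ D, S.hForm t (g.restBoost C) (g.restBoost D)
        * wedge (S.ΔForm t D B) (S.coframe t C) X Y := by
  have h : contractHom (F B) X Y = F B ![X, Y] := contract_apply (F B) X Y
  simp [boostedForm, LinearMap.sum_apply, wedgeForm_apply, h, extDerivForm_apply]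

theorem boostedForm_self (F : Fin (p + 1) → TwoForm d M) (B : Fin (p + 1)) (X : VField d M) :
    S.boostedForm t g F B X X = 0 := by
  have h1 : F B ![X, X] = 0 := Fn.eq_zero_of_add_self (by linear_combination (F B).swap X X)
  have h2 : extDeriv (S.hForm t (g.restBoost B)) X X = 0 :=
    Fn.eq_zero_of_add_self (by linear_combination extDeriv_swap (S.hForm t (g.restBoost B)) X X)
  simp [boostedForm_apply, wedge, h1, h2]

theorem transformed_eq (F : Fin (p + 1) → TwoForm d M) (A : Fin (p + 1)) (X Y : VField d M) :
    S.transformed t g F A X Y = ∑ B, g.lam B A * S.boostedForm t g F B X Y := by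
  refine Finset.sum_congr rfl fun B _ => ?_
  congr 1
  rw [boostedForm_apply]
  simp only [Fn.half_smul, Δ_eq, eta_apply, ite_mul, mul_ite, zero_mul, mul_zero,
    Finset.sum_ite_eq, Finset.mem_univ, if_true]
  rfl

/-- The transformed field strength as a tuple of 2-forms. -/
def transformedForm (F : Fin (p + 1) → TwoForm d M) (A : Fin (p + 1)) : TwoForm d M :=
  TwoForm.mk (∑ B, g.lam B A • S.boostedForm t g F B) fun X => by
    simp [LinearMap.sum_apply, boostedForm_self]

theorem transformedForm_apply (F : Fin (p + 1) → TwoForm d M) (A : Fin (p + 1))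
    (X Y : VField d M) : S.transformedForm t g F A ![X, Y] = S.transformed t g F A X Y := by
  rw [transformedForm, TwoForm.mk_apply, transformed_eq]
  simp [LinearMap.sum_apply]

/-- Gauge conditions only test a transverse second argument, for which all terms containing `τ^C(V)`
vanish. -/
theorem boostedForm_of_mem (F : Fin (p + 1) → TwoForm d M) (B : Fin (p + 1)) (X : VField d M)
    {V : VField d M} (hV : V ∈ S.Ker) :
    S.boostedForm t g F B X V = F B ![X, V] + extDeriv (S.hForm t (g.restBoost B)) X V
    + Fn.half * ∑ D, S.coframe t D X * lieDeriv V (S.hForm t (g.restBoost D) (g.restBoost B))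
    + ∑ D, (S.ΔForm t D B X * S.hForm t (g.restBoost D) V
      - S.ΔForm t D B V * S.hForm t (g.restBoost D) X)
    - ∑ C, ∑ D, Fn.half * (sgn d M D * sgn d M C * extDeriv (S.coframe t C) (t B) (t D))
        * S.hForm t (g.restBoost D) V * S.coframe t C X
    + ∑ C, ∑ D, S.hForm t (g.restBoost C) (g.restBoost D) * S.ΔForm t D B V
      * S.coframe t C X := by
  rw [boostedForm_apply]
  simp only [wedge, S.coframe_of_mem t _ hV, mul_zero, zero_mul, sub_zero, zero_sub, mul_neg,
    Finset.sum_neg_distrib, sub_neg_eq_add, ← sub_eq_add_neg, mul_assoc]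
  rfl

/-! ### The transformation law modulo gauge, for a connection inducing the class of `F`. -/

section Core

variable {S} {D : Connection d M} (hc : S.IsCompatible D) (ht : ∀ X Y, D.torsion X Y = 0)
  {F : Fin (p + 1) → TwoForm d M}
  (hF : S.IsGauge t fun A X Y => F A ![X, Y] - S.inducedFieldStrength t D A X Y)

include hc ht

theorem hForm_act_conn_boosted (B : Fin (p + 1)) (X : VField d M) {V : VField d M}
    (hV : V ∈ S.Ker) : S.hForm (t.act g) (D X (boosted t g B)) V
      = S.hForm t (D X (t B)) V + S.hForm t (D X (g.restBoost B)) V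
        - ∑ C, S.connForm t C B X * S.hForm t (g.restBoost C) V := by
  rw [S.hForm_act_of_mem t g _ hV, boosted, D.add_right, map_add, LinearMap.add_apply]
  simp only [map_add, S.coframe_of_mem t _ (hc.mem_ker X (g.restBoost_mem_ker B)), add_zero,
    S.coframe_conn_frame t hc ht]

theorem extDeriv_hForm_restBoost (B : Fin (p + 1)) (X : VField d M) {V : VField d M}
    (hV : V ∈ S.Ker) : extDeriv (S.hForm t (g.restBoost B)) X V
      = S.hForm t (D X (g.restBoost B)) V - lieDeriv V (S.hForm t (g.restBoost B) X)
        + S.hForm t (g.restBoost B) (D V X) := by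
  rw [extDeriv, hc.lieDeriv_hForm t X (g.restBoost_mem_ker B) hV, Connection.bracket_eq ht,
    map_sub]
  ring

include hF

theorem boosted_gauge_ker (B : Fin (p + 1)) {U V : VField d M} (hU : U ∈ S.Ker)
    (hV : V ∈ S.Ker) : S.hForm (t.act g) (D U (boosted t g B)) V
      - S.hForm (t.act g) (D V (boosted t g B)) U - S.boostedForm t g F B U V = 0 := by
  have e1 := hF.2 B U hU V hV
  simp only [inducedFieldStrength_eq] at e1
  rw [hForm_act_conn_boosted t g hc ht B U hV, hForm_act_conn_boosted t g hc ht B V hU,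
    S.boostedForm_of_mem t g F B U hV, extDeriv_hForm_restBoost t g hc ht B U hV,
    hc.lieDeriv_hForm t V (g.restBoost_mem_ker B) hU]
  simp only [connForm_eq, S.coframe_of_mem t _ hU, S.coframe_of_mem t _ hV, mul_zero, zero_mul,
    Finset.sum_const_zero, sub_zero, neg_mul, Finset.sum_neg_distrib, Finset.sum_sub_distrib]
  linear_combination -e1

theorem boosted_gauge_frame (A B : Fin (p + 1)) {V : VField d M} (hV : V ∈ S.Ker) :
    S.hForm (t.act g) (D (boosted t g A) (boosted t g B)) V
      - S.boostedForm t g F B (boosted t g A) V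
      = -(S.hForm (t.act g) (D (boosted t g B) (boosted t g A)) V
        - S.boostedForm t g F A (boosted t g B) V) := by
  -- Beyond the first two terms the right side is visibly antisymmetric in `A, B`, and those two are
  -- governed by the gauge condition on `F`. The term `½ τ^D ∧ d(h(W_D, W_B))` of (∗) is what makes
  -- the part quadratic in `W` antisymmetric.
  have key : ∀ A B, S.hForm (t.act g) (D (boosted t g A) (boosted t g B)) V
      - S.boostedForm t g F B (boosted t g A) V
      = S.hForm t (D (t A) (t B)) V - F B ![t A, V] + S.hForm t (D V (t B)) (g.restBoost A)
        - S.hForm t (D V (t A)) (g.restBoost B)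
        + Fn.half * (S.hForm t (D V (g.restBoost B)) (g.restBoost A)
          - S.hForm t (D V (g.restBoost A)) (g.restBoost B)) := by
    intro A B
    have e1 := hF.2 B _ (g.restBoost_mem_ker A) V hV
    simp only [inducedFieldStrength_eq] at e1
    -- Because `τ^D(τ_A + W_A) = δ^D_A`, the part of the connection form not contained in `Δ`
    -- becomes the `dτ^F(τ_B, τ_E)` term of (∗).
    have e2 : ∑ C, S.connForm t C B (boosted t g A) * S.hForm t (g.restBoost C) V
        = ∑ C, Fn.half * (sgn d M C * sgn d M A * extDeriv (S.coframe t A) (t B) (t C))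
            * S.hForm t (g.restBoost C) V
          - ∑ C, S.ΔForm t C B (boosted t g A) * S.hForm t (g.restBoost C) V := by
      rw [← Finset.sum_sub_distrib]
      refine Finset.sum_congr rfl fun C _ => ?_
      simp only [connForm_eq, S.coframe_boosted, mul_ite, mul_one, mul_zero, Finset.sum_ite_eq',
        Finset.mem_univ, if_true, extDeriv_swap _ (t C) (t B)]
      ring
    -- The last term of (∗) cancels the contribution `Δ(V) h(W, W)` coming from `Δ ∧ h(W)`.
    have e3 : ∑ C, S.ΔForm t C B V * S.hForm t (g.restBoost C) (g.restBoost A)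
        = ∑ C, S.hForm t (g.restBoost A) (g.restBoost C) * S.ΔForm t C B V :=
      Finset.sum_congr rfl fun C _ => by rw [S.hForm_symm t (g.restBoost A), mul_comm]
    have e4 : ∀ X, S.hForm t X (boosted t g A) = S.hForm t X (g.restBoost A) := fun X => by
      rw [boosted, map_add, hForm_frame_right, zero_add]
    rw [hForm_act_conn_boosted t g hc ht B _ hV, S.boostedForm_of_mem t g F B _ hV,
      extDeriv_hForm_restBoost t g hc ht B _ hV, e2, e4]
    simp only [S.coframe_boosted, mul_ite, ite_mul, mul_one, mul_zero, one_mul, zero_mul,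
      Finset.sum_ite_eq', Finset.sum_ite_irrel, Finset.sum_const_zero,
      Finset.mem_univ, if_true, Finset.sum_sub_distrib, e4, e3]
    have e5 : S.hForm t (D (boosted t g A) (t B)) V = S.hForm t (D (t A) (t B)) V
        + S.hForm t (D (g.restBoost A) (t B)) V := by
      rw [boosted, D.add_left, map_add, LinearMap.add_apply]
    have e6 : F B ![boosted t g A, V] = F B ![t A, V] + F B ![g.restBoost A, V] :=
      (F B).add_left _ _ _
    have e7 : S.hForm t (g.restBoost B) (D V (boosted t g A))
        = S.hForm t (D V (t A)) (g.restBoost B)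
          + S.hForm t (D V (g.restBoost A)) (g.restBoost B) := by
      rw [boosted, D.add_right, map_add, S.hForm_symm t (g.restBoost B),
        S.hForm_symm t (g.restBoost B)]
    rw [e5, e6, e7, hc.lieDeriv_hForm t V (g.restBoost_mem_ker A) (g.restBoost_mem_ker B),
      hc.lieDeriv_hForm t V (g.restBoost_mem_ker B) (g.restBoost_mem_ker A),
      S.hForm_symm t (g.restBoost A) (D V _), S.hForm_symm t (g.restBoost B) (D V _)]
    have h2 := Fn.two_mul_half (d := d) (M := M)
    linear_combination -e1 - S.hForm t (D V (g.restBoost B)) (g.restBoost A) * h2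
  rw [key A B, key B A]
  have e1 := hF.1 A B V hV
  simp only [inducedFieldStrength_eq, hForm_frame_right] at e1
  linear_combination -e1

/-- The field strength which a compatible torsion-free connection induces with respect to the
transformed frame is given by the transformation law. -/
theorem cls_inducedForm_act :
    S.cls (t.act g) (S.inducedForm (t.act g) D)
      = S.cls (t.act g) (S.transformedForm t g F) := by
  let K : Fin (p + 1) → VField d M → VField d M → Fn d M := fun B X Y =>
    S.hForm (t.act g) (D X (boosted t g B)) Y - S.hForm (t.act g) (D Y (boosted t g B)) X
      - S.boostedForm t g F B X Y
  have hK : ∀ A X Y, S.inducedForm (t.act g) D A ![X, Y] - S.transformedForm t g F A ![X, Y]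
      = ∑ B, g.lam B A * K B X Y := by
    intro A X Y
    rw [inducedForm_apply, transformedForm_apply, inducedFieldStrength_act, transformed_eq,
      ← Finset.sum_sub_distrib]
    exact Finset.sum_congr rfl fun B _ => by ring
  rw [cls_eq_iff]
  simp only [hK]
  refine ⟨fun A C V hV => ?_, fun A U hU V hV => ?_⟩
  · have h1 : ∀ B E, K B (boosted t g E) V = -K E (boosted t g B) V := by
      intro B E
      have h := boosted_gauge_frame t g hc ht hF E B hV
      have h0 : ∀ X B, S.hForm (t.act g) X (boosted t g B) = 0 := fun X B => by
        rw [S.hForm_symm, hForm_act_boosted_left]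
      simp only [K, h0, sub_zero]
      exact h
    -- With this the index of the tuple and the index of the frame argument are both rotated by `Λ`,
    -- so antisymmetry passes from `τ_B + W_B` to the new frame.
    have h2 : ∀ B C, K B (t.act g C) V = ∑ E, g.lam E C * K B (boosted t g E) V := by
      intro B C
      let L : OneForm d M :=
        (S.hForm (t.act g)).flip V ∘ₗ D.leftHom (boosted t g B)
          - S.hForm (t.act g) (D V (boosted t g B)) - (S.boostedForm t g F B).flip V
      have hL : ∀ X, K B X V = L X := fun _ => rfl
      simp only [hL]
      rw [act_eq_sum_boosted, map_sum]
      simp only [map_smul, smul_eq_mul]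
    simp only [h2, Finset.mul_sum]
    rw [Finset.sum_comm, ← Finset.sum_neg_distrib]
    refine Finset.sum_congr rfl fun E _ => ?_
    rw [← Finset.sum_neg_distrib]
    refine Finset.sum_congr rfl fun B _ => ?_
    rw [h1]
    ring
  · exact Finset.sum_eq_zero fun B _ => by
      rw [show K B U V = 0 from boosted_gauge_ker t g hc ht hF B hU hV, mul_zero]

end Core

end PNCStructure

/-! ### The group action on pairs and its orbit space. -/

namespace PNCStructure

variable {d p : ℕ} {M : Type*} [TopologicalSpace M]
  [ChartedSpace (EuclideanSpace ℝ (Fin d)) M] [IsManifold (𝓡 d) ∞ M] [T2Space M]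
  (S : PNCStructure d p M)

/-- The components are read off by the co-frame and the projector: `Λ^B_A = τ^B(τ'_A)` and `V_A = P
τ'_A`. Orthonormality of both frames is the Lorentz condition. -/
theorem existsUnique_act (t t' : S.LongitudinalFrame) :
    ∃! g : S.LG, ∀ A, t' A = ∑ B, g.lam B A • t B + g.boost A := by
  have hexp : ∀ A, t' A = ∑ B, S.coframe t B (t' A) • t B + S.proj t (t' A) :=
    fun A => S.frame_expand t (t' A)
  refine ⟨⟨Matrix.of fun B A => S.coframe t B (t' A), fun A => S.proj t (t' A), ?_,
    fun A => S.proj_mem_ker t _⟩, hexp, fun g hg => ?_⟩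
  · ext1 A C
    rw [← t'.orthonormal, S.τ_eq t, Matrix.mul_apply]
    refine Finset.sum_congr rfl fun B _ => ?_
    rw [Matrix.mul_apply]
    simp only [Matrix.transpose_apply, Matrix.of_apply, eta_apply, mul_ite, mul_zero,
      Finset.sum_ite_eq', Finset.mem_univ, if_true]
    ring
  · have hlam : ∀ A B, S.coframe t B (t' A) = g.lam B A := fun A B => by
      rw [hg A]
      exact S.coframe_act_frame t g B A
    refine LG.ext (Matrix.ext fun B A => (hlam A B).symm) (funext fun A => ?_)
    have h := hg A
    rw [hexp A] at h
    simp only [hlam] at h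
    exact (add_left_cancel h).symm

omit [T2Space M] in
theorem LongitudinalFrame.act_one {S : PNCStructure d p M} (t : S.LongitudinalFrame) :
    t.act 1 = t := by
  refine LongitudinalFrame.ext (funext fun A => ?_)
  change ∑ B, (1 : Matrix (Fin (p + 1)) (Fin (p + 1)) (Fn d M)) B A • t B + 0 = t A
  simp [Matrix.one_apply]

omit [T2Space M] in
theorem LongitudinalFrame.act_mul {S : PNCStructure d p M} (t : S.LongitudinalFrame)
    (g g' : S.LG) : t.act (g * g') = (t.act g).act g' := by
  refine LongitudinalFrame.ext (funext fun A => ?_)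
  simp only [LongitudinalFrame.act, LG.mul_lam, LG.mul_boost, Matrix.mul_apply, smul_add,
    Finset.sum_smul, Finset.smul_sum, Finset.sum_add_distrib, smul_smul, ← add_assoc]
  rw [Finset.sum_comm]
  simp only [mul_comm]

variable {S} (hS : S.IsAugustinian)

/-- The connection of a pair. -/
def connection (x : S.Pair) : Connection d M := (S.existsUnique_mapsTo hS x).choose

theorem mapsTo_connection (x : S.Pair) : S.MapsTo x (connection hS x) :=
  (S.existsUnique_mapsTo hS x).choose_spec.1

theorem mapsTo_iff_connection_eq (x : S.Pair) (D : Connection d M) :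
    S.MapsTo x D ↔ connection hS x = D := by
  constructor
  · intro h
    exact (S.existsUnique_mapsTo hS x).unique (mapsTo_connection hS x) h
  · rintro rfl
    exact mapsTo_connection hS x

theorem connection_mem (x : S.Pair) : S.IsCompatible (connection hS x) ∧
    ∀ X Y, (connection hS x).torsion X Y = 0 :=
  ((S.mapsTo_iff x.1 hS x.2 _).mp (mapsTo_connection hS x)).1

theorem cls_connection (x : S.Pair) :
    S.cls x.1 (S.inducedForm x.1 (connection hS x)) = x.2 :=
  ((S.mapsTo_iff x.1 hS x.2 _).mp (mapsTo_connection hS x)).2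

/-- The pair of a longitudinal frame and a connection. -/
def pairOf (t : S.LongitudinalFrame) (D : Connection d M) : S.Pair :=
  ⟨t, S.cls t (S.inducedForm t D)⟩

/-- Together with `connection_pairOf` this identifies pairs with frames times connections. -/
theorem pairOf_connection (x : S.Pair) : pairOf x.1 (connection hS x) = x :=
  Sigma.ext rfl (heq_of_eq (cls_connection hS x))

theorem connection_pairOf (t : S.LongitudinalFrame) {D : Connection d M}
    (hD : S.IsCompatible D ∧ ∀ X Y, D.torsion X Y = 0) : connection hS (pairOf t D) = D :=
  (mapsTo_iff_connection_eq hS _ D).mp ((S.mapsTo_iff t hS _ D).mpr ⟨hD, rfl⟩)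

/-- The right action on pairs: the frame is transformed and the connection is kept. -/
@[reducible]
def pairAction : MulAction (S.LG)ᵐᵒᵖ S.Pair where
  smul g x := pairOf (x.1.act g.unop) (connection hS x)
  one_smul x := by
    change pairOf (x.1.act 1) (connection hS x) = x
    rw [x.1.act_one, pairOf_connection]
  -- Taking opposites reverses products, so a left action of the opposite group encodes the right
  -- action. The connection is unchanged by the first step, which leaves only the composition law
  -- for frames.
  mul_smul g g' x := by
    change pairOf (x.1.act (g'.unop * g.unop)) (connection hS x)
      = pairOf ((x.1.act g'.unop).act g.unop)
        (connection hS (pairOf (x.1.act g'.unop) (connection hS x)))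
    rw [connection_pairOf hS _ (connection_mem hS x), x.1.act_mul]

theorem transformation_law (hS : S.IsAugustinian) {t : S.LongitudinalFrame} {g : S.LG}
    {F F' : Fin (p + 1) → TwoForm d M}
    {D : Connection d M} (h : S.MapsTo ⟨t, S.cls t F⟩ D)
    (h' : S.MapsTo ⟨t.act g, S.cls (t.act g) F'⟩ D) :
    S.cls (t.act g) F' = S.cls (t.act g) (S.transformedForm t g F) := by
  obtain ⟨⟨hc, ht⟩, h1⟩ := (S.mapsTo_iff t hS _ D).mp h
  obtain ⟨-, h2⟩ := (S.mapsTo_iff _ hS _ D).mp h'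
  rw [← h2]
  exact cls_inducedForm_act t g hc ht ((S.cls_eq_iff t _ _).mp h1.symm)

end PNCStructure
end PNC
end

theorem mainTheorem7 (d p : ℕ) (M : Type*) [TopologicalSpace M] [T2Space M]
    [SecondCountableTopology M] [ChartedSpace (EuclideanSpace ℝ (Fin d)) M]
    [IsManifold (𝓡 d) ∞ M] (S : PNC.PNCStructure d p M) (hS : S.IsAugustinian)
    (hframe : Nonempty S.LongitudinalFrame) :
    -- any two longitudinal frames are related by a unique local Lorentz transformation and boost
    (∀ t t' : S.LongitudinalFrame, ∃! g : S.LG,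
      ∀ A, t' A = ∑ B, g.lam B A • t B + g.boost A) ∧
    -- transformation of the coframes
    (∀ (t : S.LongitudinalFrame) (g : S.LG) (A : Fin (p + 1)),
      S.coframe (t.act g) A = ∑ B, g.lam⁻¹ A B • S.coframe t B) ∧
    -- pairs which map to the same connection are related by the transformation law
    (∀ (t : S.LongitudinalFrame) (g : S.LG) (F F' : Fin (p + 1) → PNC.TwoForm d M)
      (D : PNC.Connection d M),
      S.MapsTo ⟨t, S.cls t F⟩ D → S.MapsTo ⟨t.act g, S.cls (t.act g) F'⟩ D →
      ∃ G : Fin (p + 1) → PNC.TwoForm d M,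
        (∀ A X Y, G A ![X, Y] = S.transformed t g F A X Y) ∧
        S.cls (t.act g) F' = S.cls (t.act g) G) ∧
    -- the transformation law is a right action, whose orbit space is in canonical bijection with
    -- the space of torsion-free compatible connections
    (∃ act : MulAction (S.LG)ᵐᵒᵖ S.Pair,
      (∀ (t : S.LongitudinalFrame) (g : S.LG) (F : Fin (p + 1) → PNC.TwoForm d M),
        ∃ G : Fin (p + 1) → PNC.TwoForm d M,
          (∀ A X Y, G A ![X, Y] = S.transformed t g F A X Y) ∧
          MulOpposite.op g • (⟨t, S.cls t F⟩ : S.Pair) = ⟨t.act g, S.cls (t.act g) G⟩) ∧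
      ∃ Φ : MulAction.orbitRel.Quotient (S.LG)ᵐᵒᵖ S.Pair → S.TorsionFreeConnection,
        Function.Bijective Φ ∧
        ∀ (x : S.Pair) (D : PNC.Connection d M),
          S.MapsTo x D ↔ (Φ (Quotient.mk _ x)).1 = D) := by
  open PNC.PNCStructure in
  refine ⟨S.existsUnique_act, fun t g => S.coframe_act t g, fun t g F F' D h h' =>
    ⟨S.transformedForm t g F, S.transformedForm_apply t g F, transformation_law hS h h'⟩,
    pairAction hS, fun t g F => ⟨S.transformedForm t g F, S.transformedForm_apply t g F, ?_⟩, ?_⟩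
  -- The action was defined by keeping the connection. Old and new pair map to the same one, so the
  -- transformation law identifies the new class with (∗).
  · have hx := mapsTo_connection hS ⟨t, S.cls t F⟩
    have hy : S.MapsTo (pairOf (t.act g) (connection hS ⟨t, S.cls t F⟩))
        (connection hS ⟨t, S.cls t F⟩) :=
      (mapsTo_iff_connection_eq hS _ _).mpr (connection_pairOf hS _ (connection_mem hS _))
    exact Sigma.ext rfl (heq_of_eq (transformation_law hS hx hy))
  · let := pairAction hS
    have hsmul : ∀ (g : (S.LG)ᵐᵒᵖ) (x : S.Pair),
        g • x = pairOf (x.1.act g.unop) (connection hS x) := fun _ _ => rfl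
    have hinv : ∀ (g : (S.LG)ᵐᵒᵖ) (x : S.Pair), connection hS (g • x) = connection hS x :=
      fun g x => by rw [hsmul, connection_pairOf hS _ (connection_mem hS x)]
    refine ⟨Quotient.lift (fun x => ⟨connection hS x, connection_mem hS x⟩) ?_, ⟨?_, ?_⟩, ?_⟩
    · rintro x y ⟨g, rfl⟩
      exact Subtype.ext (hinv g y)
    -- Injectivity: the group element relating the two frames carries `y` to the pair with the frame
    -- of `x` and the common connection, and that pair is `x`.
    · rintro ⟨x⟩ ⟨y⟩ h
      have h1 : connection hS x = connection hS y := congrArg Subtype.val h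
      obtain ⟨g, hg, -⟩ := S.existsUnique_act y.1 x.1
      refine Quotient.sound ⟨MulOpposite.op g, ?_⟩
      have h2 : x.1 = y.1.act g := PNC.PNCStructure.LongitudinalFrame.ext (funext hg)
      change pairOf (y.1.act g) (connection hS y) = x
      rw [← h1, ← h2, pairOf_connection]
    -- Surjectivity: any global frame, together with the class that `D` induces on it, is a
    -- preimage.
    · rintro ⟨D, hD⟩
      obtain ⟨t⟩ := hframe
      exact ⟨Quotient.mk _ (pairOf t D), Subtype.ext (connection_pairOf hS t hD)⟩
    · exact fun x D => mapsTo_iff_connection_eq hS x D
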